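/- Let $I\subset\mathbb{R}$ be a bounded nondegenerate interval and write $\langle\psi\rangle_J=\frac1{|J|}\int_J\psi$. A real-valued $\varphi\in L^1(I)$ belongs to $\mathrm{BMO}(I)$ if $$\|\varphi\|_{\mathrm{BMO}(I)}=\Big(\sup_{J}\big\langle|\varphi-\langle\varphi\rangle_J|^2\big\rangle_J\Big)^{1/2}<\infty,$$ where the supremum is over all nondegenerate subintervals $J\subseteq I$. Let $p\ge 1$ and $\max(2,p)\le r<\infty$. Then every $\varphi\in\mathrm{BMO}(I)$ with $\langle\varphi\rangle_I=0$ lies in $L^r(I)$ and satisfies $$\|\varphi\|_{L^r(I)}\le\Big(\frac{\Gamma(r+1)}{\Gamma(p+1)}\Big)^{\frac1r}\|\varphi\|_{L^p(I)}^{\frac pr}\,\|\varphi\|_{\mathrm{BMO}(I)}^{1-\frac pr}$$ (with the convention $0^0=1$). For every such $I$, $p$, $r$ the constant $\big(\Gamma(r+1)/\Gamma(p+1)\big)^{1/r}$ is the smallest one for which this inequality holds for all $\varphi\in\mathrm{BMO}(I)$ with $\langle\varphi\rangle_I=0$. Moreover, on $I=(-2,2)$ the function $$\varphi_0(t)=\begin{cases}-\ln(2-t),&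 t\in[1,2),\\ 0,& t\in[-1,1],\\ \ln(t+2),& t\in(-2,-1],\end{cases}$$ is a nonzero element of $\mathrm{BMO}(I)$ with $\langle\varphi_0\rangle_I=0$, and the inequality is an equality for $\varphi_0$. -/

import Mathlib

open MeasureTheory
open scoped ENNReal

/-- A bounded nondegenerate interval of the real line (the endpoints may or may not belong to it). -/
def IsBoundedInterval (I : Set ℝ) : Prop :=
  I.OrdConnected ∧ Bornology.IsBounded I ∧ (interior I).Nonempty

/-- The quadratic `BMO` seminorm on `I`: the square root of the supremum, over all subintervals `J`
of `I`, of the average over `J` of `|φ - ⟨φ⟩_J|²`; it may be infinite. -/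
noncomputable def bmoSeminorm (φ : ℝ → ℝ) (I : Set ℝ) : ℝ≥0∞ :=
  (⨆ (J : Set ℝ) (_ : IsBoundedInterval J ∧ J ⊆ I),
    ⨍⁻ t in J, ‖φ t - ⨍ s in J, φ s‖ₑ ^ 2 ∂volume) ^ (1 / 2 : ℝ)

/-- `φ ∈ BMO(I)`: `φ` is integrable on `I` with finite quadratic `BMO` seminorm. -/
def MemBMO (φ : ℝ → ℝ) (I : Set ℝ) : Prop :=
  IntegrableOn φ I ∧ bmoSeminorm φ I < ∞

/-- The norm of `L^q(I)`, for a real exponent `q`, with respect to Lebesgue measure. -/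
noncomputable def lpNormOn (φ : ℝ → ℝ) (q : ℝ) (I : Set ℝ) : ℝ≥0∞ :=
  eLpNorm φ (ENNReal.ofReal q) (volume.restrict I)

/-- The constant `(Γ(r+1) / Γ(p+1))^(1/r)`. -/
noncomputable def multConst (p r : ℝ) : ℝ :=
  (Real.Gamma (r + 1) / Real.Gamma (p + 1)) ^ (1 / r)

/-- The extremal function, to be considered on the interval `(-2, 2)` only. -/
noncomputable def phiZero (t : ℝ) : ℝ :=
  if 1 ≤ t then -Real.log (2 - t) else if -1 ≤ t then 0 else Real.log (t + 2)

/-!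
Let `ψ` have mean at most `0` and `BMO` seminorm at most `1` on an interval. The interval splits
into an initial part of mean zero and the rising-sun set of the primitive of `ψ`: on the initial
part and on each component of the rising-sun set `ψ` has mean zero, so its square has average at
most `1`, while `ψ ≤ 0` elsewhere. Integrating `(x + 1)₊² / 2 - (x + 1)₊ ≤ (x² - 1) / 2` over these
pieces gives `∫ (ψ + 1)₊² / 2 ≤ ∫ (ψ + 1)₊`. Applied to `±φ - (c + 1)` this says that
`S c = ∫ (|φ| - c)₊² / 2` and `T c = ∫ (|φ| - c)₊` satisfy `S ≤ T` on `[0, ∞)`.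

Since `S` has derivative `-T`, `exp c * S c` decreases. By the beta integral the normalised moment
`∫ |φ|^q / Γ(q + 1)` is the average of `exp c * S c` against the gamma density of shape `q - 2` if
`q > 2`, and that of `exp c * T c` against the gamma density of shape `q - 1` if `1 < q < 2`. Gamma
densities of different shapes cross once, so the moments decrease for `q ≥ 2`. Those with
`1 ≤ q < 2` are at least `S 0`, the moment for `q = 2`, because `S ≤ T` gives the case `q = 1` and
the integral of `T` over `[0, y]` is `S 0 - S y`, at least `(1 - exp (-y)) * S 0`. Homogeneity
restores the `BMO` norm.

The distribution of `|phiZero|` is exactly exponential, so all its normalised moments agree and the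
inequality is an equality. The quantities involved are invariant, up to a common factor, under
affine changes of variable, which moves `phiZero` to any other interval.
-/

section

open Set Filter Topology

/-- `Ioo α β` is a connected component of the open set `U`, encoded by its endpoints. -/
structure IsIntervalComponent (U : Set ℝ) (α β : ℝ) : Prop where
  lt : α < β
  Ioo_subset : Ioo α β ⊆ U
  left_notMem : α ∉ U
  right_notMem : β ∉ U

theorem IsIntervalComponent.eq_of_mem {U : Set ℝ} {α β α' β' x : ℝ}
    (h : IsIntervalComponent U α β) (h' : IsIntervalComponent U α' β')
    (hx : x ∈ Ioo α β) (hx' : x ∈ Ioo α' β') : α = α' ∧ β = β' := by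
  constructor
  · rcases lt_trichotomy α α' with hlt | heq | hlt
    · exact absurd (h.Ioo_subset ⟨hlt, hx'.1.trans hx.2⟩) h'.left_notMem
    · exact heq
    · exact absurd (h'.Ioo_subset ⟨hlt, hx.1.trans hx'.2⟩) h.left_notMem
  · rcases lt_trichotomy β β' with hlt | heq | hlt
    · exact absurd (h'.Ioo_subset ⟨hx'.1.trans hx.2, hlt⟩) h.right_notMem
    · exact heq
    · exact absurd (h.Ioo_subset ⟨hx.1.trans hx'.2, hlt⟩) h'.right_notMem

theorem exists_isIntervalComponent {U : Set ℝ} (hU : IsOpen U) {a b x : ℝ} (hb : U ⊆ Ioo a b)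
    (hx : x ∈ U) : ∃ α β, IsIntervalComponent U α β ∧ x ∈ Ioo α β := by
  have haU : a ∈ Uᶜ ∩ Iic x := ⟨fun h => lt_irrefl _ (hb h).1, (hb hx).1.le⟩
  have hbU : b ∈ Uᶜ ∩ Ici x := ⟨fun h => lt_irrefl _ (hb h).2, (hb hx).2.le⟩
  obtain ⟨⟨hαU, hαx⟩, hα⟩ := (hU.isClosed_compl.inter isClosed_Iic).isGreatest_csSup ⟨a, haU⟩
    (bddAbove_Iic.mono inter_subset_right)
  obtain ⟨⟨hβU, hxβ⟩, hβ⟩ := (hU.isClosed_compl.inter isClosed_Ici).isLeast_csInf ⟨b, hbU⟩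
    (bddBelow_Ici.mono inter_subset_right)
  set α := sSup (Uᶜ ∩ Iic x)
  set β := sInf (Uᶜ ∩ Ici x)
  have hα_lt : α < x := lt_of_le_of_ne hαx fun h => hαU (h ▸ hx)
  have hlt_β : x < β := lt_of_le_of_ne hxβ fun h => hβU (h ▸ hx)
  refine ⟨α, β, ⟨hα_lt.trans hlt_β, fun y hy => ?_, hαU, hβU⟩, hα_lt, hlt_β⟩
  by_contra hyU
  rcases le_total y x with hyx | hyx
  · exact hy.1.not_ge (hα ⟨hyU, hyx⟩)
  · exact hy.2.not_ge (hβ ⟨hyU, hyx⟩)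

theorem setIntegral_nonpos_of_components {U : Set ℝ} (hU : IsOpen U) {a b : ℝ} (hb : U ⊆ Ioo a b)
    {f : ℝ → ℝ} (hf : IntegrableOn f U)
    (h : ∀ α β, IsIntervalComponent U α β → ∫ t in Ioo α β, f t ≤ 0) :
    ∫ t in U, f t ≤ 0 := by
  let 𝒞 : Set (ℝ × ℝ) := {c | IsIntervalComponent U c.1 c.2}
  have hdisj : 𝒞.PairwiseDisjoint fun c => Ioo c.1 c.2 := by
    intro c hc c' hc' hne
    refine Set.disjoint_left.2 fun x hx hx' => hne ?_
    exact Prod.ext_iff.2 (hc.eq_of_mem hc' hx hx')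
  have : Countable 𝒞 := hdisj.countable_of_isOpen (fun _ _ => isOpen_Ioo)
    fun _ hc => nonempty_Ioo.2 hc.lt
  have hunion : U = ⋃ c : 𝒞, Ioo c.1.1 c.1.2 := by
    refine Subset.antisymm (fun x hx => ?_) (iUnion_subset fun c => c.2.Ioo_subset)
    obtain ⟨α, β, hαβ, hx⟩ := exists_isIntervalComponent hU hb hx
    exact mem_iUnion.2 ⟨⟨(α, β), hαβ⟩, hx⟩
  rw [hunion] at hf ⊢
  rw [integral_iUnion (fun _ => measurableSet_Ioo) (hdisj.subtype _ _) hf]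
  exact tsum_nonpos fun c => h _ _ c.2

/-- The shadow of the graph of `f` over `(a, b)` in the rising sun lemma: the points at which a
larger value of `f` occurs further to the right. -/
def shadow (f : ℝ → ℝ) (a b : ℝ) : Set ℝ :=
  {t ∈ Ioo a b | ∃ s ∈ Ioc t b, f t < f s}

theorem shadow_subset {f : ℝ → ℝ} {a b : ℝ} : shadow f a b ⊆ Ioo a b :=
  sep_subset _ _

theorem isOpen_shadow {f : ℝ → ℝ} {a b : ℝ} (hf : ContinuousOn f (Icc a b)) :
    IsOpen (shadow f a b) := by
  rw [isOpen_iff_mem_nhds]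
  rintro t ⟨ht, s, hs, hts⟩
  have hft : ContinuousAt f t := hf.continuousAt (Icc_mem_nhds ht.1 ht.2)
  filter_upwards [isOpen_Ioo.mem_nhds ht, hft.eventually (gt_mem_nhds hts),
    gt_mem_nhds hs.1] with x hx hfx hxs
  exact ⟨hx, s, ⟨hxs, hs.2⟩, hfx⟩

theorem IsIntervalComponent.Icc_subset {a b α β : ℝ} {U : Set ℝ} (hb : U ⊆ Ioo a b)
    (h : IsIntervalComponent U α β) : Icc α β ⊆ Icc a b := by
  rw [← closure_Ioo h.lt.ne]
  exact closure_minimal (h.Ioo_subset.trans (hb.trans Ioo_subset_Icc_self)) isClosed_Icc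

theorem le_of_mem_shadow_component {f : ℝ → ℝ} {a b α β t : ℝ} (hf : ContinuousOn f (Icc a b))
    (h : IsIntervalComponent (shadow f a b) α β) (ht : t ∈ Ioo α β) : f t ≤ f β := by
  have hsub : Icc t β ⊆ Icc a b :=
    (Icc_subset_Icc_left ht.1.le).trans (h.Icc_subset shadow_subset)
  obtain ⟨x, hx, hmax⟩ := isCompact_Icc.exists_isMaxOn (nonempty_Icc.2 ht.2.le) (hf.mono hsub)
  rcases hx.2.eq_or_lt with rfl | hxβ
  · exact hmax (left_mem_Icc.2 hx.1)
  · -- otherwise the value beyond `x` exceeding `f x` is taken beyond `β`, which puts `β` in shadow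
    obtain ⟨hxab, s, hs, hfs⟩ := h.Ioo_subset ⟨ht.1.trans_le hx.1, hxβ⟩
    have hβs : β < s := by
      by_contra! hsβ
      exact hfs.not_ge (hmax ⟨hx.1.trans hs.1.le, hsβ⟩)
    have hβx : f β ≤ f x := hmax (right_mem_Icc.2 ht.2.le)
    exact absurd ⟨⟨hxab.1.trans hxβ, hβs.trans_le hs.2⟩, s, ⟨hβs, hs.2⟩, hβx.trans_lt hfs⟩
      h.right_notMem

theorem le_of_shadow_component {f : ℝ → ℝ} {a b α β : ℝ} (hf : ContinuousOn f (Icc a b))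
    (h : IsIntervalComponent (shadow f a b) α β) : f α ≤ f β := by
  have hcont : ContinuousWithinAt f (Ioo α β) α :=
    (hf α (h.Icc_subset shadow_subset (left_mem_Icc.2 h.lt.le))).mono
      (Ioo_subset_Icc_self.trans (h.Icc_subset shadow_subset))
  have : (𝓝[Ioo α β] α).NeBot := left_nhdsWithin_Ioo_neBot h.lt
  exact le_of_tendsto hcont
    (eventually_nhdsWithin_of_forall fun _ ht => le_of_mem_shadow_component hf h ht)

theorem eq_of_shadow_component {f : ℝ → ℝ} {a b α β : ℝ} (hf : ContinuousOn f (Icc a b))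
    (ha : ∀ t ∈ Icc a b, f t ≤ f a) (h : IsIntervalComponent (shadow f a b) α β) : f α = f β := by
  have hαab := h.Icc_subset shadow_subset (left_mem_Icc.2 h.lt.le)
  have hβab := h.Icc_subset shadow_subset (right_mem_Icc.2 h.lt.le)
  refine le_antisymm (le_of_shadow_component hf h) ?_
  rcases hαab.1.eq_or_lt with rfl | haα
  · exact ha β hβab
  · by_contra! hlt
    exact h.left_notMem ⟨⟨haα, h.lt.trans_le hβab.2⟩, β, ⟨h.lt, hβab.2⟩, hlt⟩

theorem ae_nonpos_of_notMem_shadow {ψ : ℝ → ℝ} {a b : ℝ} (hab : a ≤ b)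
    (hψ : IntervalIntegrable ψ volume a b) :
    ∀ᵐ t, t ∈ Ioo a b → t ∉ shadow (fun t => ∫ s in a..t, ψ s) a b → ψ t ≤ 0 := by
  filter_upwards [hψ.ae_hasDerivAt_integral] with t ht htab hshadow
  have hderiv := ht (by rw [uIcc_of_le hab]; exact Ioo_subset_Icc_self htab) a left_mem_uIcc
  have hslope := (hasDerivWithinAt_iff_tendsto_slope' self_notMem_Ioi).1
    (hderiv.hasDerivWithinAt (s := Ioi t))
  refine le_of_tendsto hslope ?_
  filter_upwards [Ioo_mem_nhdsGT htab.2] with s hs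
  rw [slope_def_field]
  refine div_nonpos_of_nonpos_of_nonneg (sub_nonpos.2 ?_) (sub_nonneg.2 hs.1.le)
  by_contra! hlt
  exact hshadow ⟨htab, s, ⟨hs.1, hs.2.le⟩, hlt⟩

/-- The gain `(x + 1)₊² / 2 - (x + 1)₊` whose nonpositive average over an interval compares the
quadratic and linear tails of a function. -/
noncomputable def excess (x : ℝ) : ℝ := max (x + 1) 0 ^ 2 / 2 - max (x + 1) 0

theorem excess_le_half_sq_sub_one (x : ℝ) : excess x ≤ (x ^ 2 - 1) / 2 := by
  unfold excess
  rcases le_total (x + 1) 0 with h | h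
  · rw [max_eq_right h]; nlinarith
  · rw [max_eq_left h]; nlinarith

theorem excess_nonpos {x : ℝ} (hx : x ≤ 1) : excess x ≤ 0 := by
  unfold excess
  rcases le_total (x + 1) 0 with h | h
  · rw [max_eq_right h]; norm_num
  · rw [max_eq_left h]; nlinarith

theorem memLp_max_sub_zero {α : Type*} [MeasurableSpace α] {μ : Measure α} [IsFiniteMeasure μ]
    {f : α → ℝ} {p : ℝ≥0∞} (hf : MemLp f p μ) (c : ℝ) :
    MemLp (fun x => max (f x - c) 0) p μ :=
  (hf.sub (memLp_const c)).pos_part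

theorem integrable_excess {α : Type*} [MeasurableSpace α] {μ : Measure α} [IsFiniteMeasure μ]
    {f : α → ℝ} (hf : MemLp f 2 μ) : Integrable (fun x => excess (f x)) μ := by
  have h : MemLp (fun x => max (f x + 1) 0) 2 μ := by
    simpa only [sub_neg_eq_add] using memLp_max_sub_zero hf (-1)
  exact (h.integrable_sq.div_const 2).sub (h.integrable one_le_two)

section RisingSun

variable {a b : ℝ} {ψ : ℝ → ℝ}

theorem setIntegral_Ioo_eq_sub {α β : ℝ} (hψ : IntegrableOn ψ (Ioo a b)) (haα : a ≤ α)
    (hαβ : α ≤ β) (hβb : β ≤ b) :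
    ∫ t in Ioo α β, ψ t = (∫ t in a..β, ψ t) - ∫ t in a..α, ψ t := by
  have hint {c : ℝ} (hac : a ≤ c) (hcb : c ≤ b) : IntervalIntegrable ψ volume a c :=
    (intervalIntegrable_iff_integrableOn_Ioo_of_le hac).2 (hψ.mono_set (Ioo_subset_Ioo_right hcb))
  rw [← integral_Ioc_eq_integral_Ioo, ← intervalIntegral.integral_of_le hαβ,
    intervalIntegral.integral_interval_sub_left (hint (haα.trans hαβ) hβb)
      (hint haα (hαβ.trans hβb))]

theorem continuousOn_primitive_Icc (hab : a ≤ b) (hψ : IntegrableOn ψ (Ioo a b)) :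
    ContinuousOn (fun t => ∫ s in a..t, ψ s) (Icc a b) := by
  have := intervalIntegral.continuousOn_primitive_interval'
    ((intervalIntegrable_iff_integrableOn_Ioo_of_le hab).2 hψ) left_mem_uIcc
  rwa [uIcc_of_le hab] at this

theorem setIntegral_excess_nonpos_of_sq (hab : a ≤ b)
    (hψ : MemLp ψ 2 (volume.restrict (Ioo a b)))
    (h : ∫ t in Ioo a b, ψ t ^ 2 ≤ b - a) : ∫ t in Ioo a b, excess (ψ t) ≤ 0 := by
  have hone : Integrable (fun _ : ℝ => (1 : ℝ)) (volume.restrict (Ioo a b)) := integrable_const 1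
  calc ∫ t in Ioo a b, excess (ψ t) ≤ ∫ t in Ioo a b, (ψ t ^ 2 - 1) / 2 :=
        integral_mono (integrable_excess hψ) ((hψ.integrable_sq.sub hone).div_const 2)
          fun t => excess_le_half_sq_sub_one (ψ t)
    _ = ((∫ t in Ioo a b, ψ t ^ 2) - (b - a)) / 2 := by
        rw [integral_div, integral_sub hψ.integrable_sq hone]
        simp [Real.volume_real_Ioo_of_le hab]
    _ ≤ 0 := by linarith

theorem setIntegral_shadow_excess_nonpos (hab : a ≤ b)
    (hψ : MemLp ψ 2 (volume.restrict (Ioo a b)))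
    (hprim : ∀ t ∈ Icc a b, ∫ s in a..t, ψ s ≤ 0)
    (hsq : ∀ α β, a ≤ α → α < β → β ≤ b → ∫ t in Ioo α β, ψ t = 0 →
      ∫ t in Ioo α β, ψ t ^ 2 ≤ β - α) :
    ∫ t in shadow (fun t => ∫ s in a..t, ψ s) a b, excess (ψ t) ≤ 0 := by
  have hint : IntegrableOn ψ (Ioo a b) := hψ.integrable one_le_two
  have hcont := continuousOn_primitive_Icc hab hint
  refine setIntegral_nonpos_of_components (isOpen_shadow hcont) shadow_subset
    (IntegrableOn.mono_set (integrable_excess hψ) shadow_subset) fun α β h => ?_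
  have haα : a ≤ α := (h.Icc_subset shadow_subset (left_mem_Icc.2 h.lt.le)).1
  have hβb : β ≤ b := (h.Icc_subset shadow_subset (right_mem_Icc.2 h.lt.le)).2
  have hzero : ∫ t in Ioo α β, ψ t = 0 := by
    rw [setIntegral_Ioo_eq_sub hint haα h.lt.le hβb, sub_eq_zero]
    exact (eq_of_shadow_component hcont
      (by simpa only [intervalIntegral.integral_same] using hprim) h).symm
  exact setIntegral_excess_nonpos_of_sq h.lt.le
    (hψ.mono_measure (Measure.restrict_mono_set _ (Ioo_subset_Ioo haα hβb)))
    (hsq α β haα h.lt hβb hzero)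

theorem setIntegral_excess_nonpos_of_primitive (hab : a ≤ b)
    (hψ : MemLp ψ 2 (volume.restrict (Ioo a b)))
    (hprim : ∀ t ∈ Icc a b, ∫ s in a..t, ψ s ≤ 0)
    (hsq : ∀ α β, a ≤ α → α < β → β ≤ b → ∫ t in Ioo α β, ψ t = 0 →
      ∫ t in Ioo α β, ψ t ^ 2 ≤ β - α) :
    ∫ t in Ioo a b, excess (ψ t) ≤ 0 := by
  have hint : IntegrableOn ψ (Ioo a b) := hψ.integrable one_le_two
  have hex : IntegrableOn (fun t => excess (ψ t)) (Ioo a b) := integrable_excess hψ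
  set U := shadow (fun t => ∫ s in a..t, ψ s) a b
  have hU : MeasurableSet U := (isOpen_shadow (continuousOn_primitive_Icc hab hint)).measurableSet
  have hoff : ∫ t in Ioo a b \ U, excess (ψ t) ≤ 0 := by
    refine setIntegral_nonpos_of_ae_restrict ?_
    rw [EventuallyLE, ae_restrict_iff' (measurableSet_Ioo.diff hU)]
    filter_upwards [ae_nonpos_of_notMem_shadow hab
      ((intervalIntegrable_iff_integrableOn_Ioo_of_le hab).2 hint)] with t ht htU
    exact excess_nonpos ((ht htU.1 htU.2).trans zero_le_one)
  rw [setIntegral_sdiff hU hex shadow_subset] at hoff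
  linarith [setIntegral_shadow_excess_nonpos hab hψ hprim hsq]

theorem exists_zero_forall_Icc_nonpos {f : ℝ → ℝ} (hab : a ≤ b) (hf : ContinuousOn f (Icc a b))
    (ha : f a = 0) (hb : f b ≤ 0) : ∃ c ∈ Icc a b, f c = 0 ∧ ∀ t ∈ Icc c b, f t ≤ 0 := by
  have hcompact : IsCompact (Icc a b ∩ f ⁻¹' {0}) :=
    isCompact_Icc.of_isClosed_subset (hf.preimage_isClosed_of_isClosed isClosed_Icc
      isClosed_singleton) inter_subset_left
  obtain ⟨c, ⟨hcab, hc⟩, hmax⟩ := hcompact.exists_isGreatest ⟨a, left_mem_Icc.2 hab, ha⟩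
  refine ⟨c, hcab, hc, fun t ht => ?_⟩
  by_contra! hpos
  obtain ⟨z, hz, hfz⟩ := intermediate_value_Icc' ht.2
    (hf.mono (Icc_subset_Icc_left (hcab.1.trans ht.1))) ⟨hb, hpos.le⟩
  have hzc : z ≤ c := hmax ⟨⟨hcab.1.trans (ht.1.trans hz.1), hz.2⟩, hfz⟩
  have hzt : z = t := le_antisymm (hzc.trans ht.1) hz.1
  exact hpos.ne' (hzt ▸ hfz)

theorem setIntegral_excess_nonpos (hab : a ≤ b) (hψ : MemLp ψ 2 (volume.restrict (Ioo a b)))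
    (hmean : ∫ t in Ioo a b, ψ t ≤ 0)
    (hsq : ∀ α β, a ≤ α → α < β → β ≤ b → ∫ t in Ioo α β, ψ t = 0 →
      ∫ t in Ioo α β, ψ t ^ 2 ≤ β - α) :
    ∫ t in Ioo a b, excess (ψ t) ≤ 0 := by
  have hint : IntegrableOn ψ (Ioo a b) := hψ.integrable one_le_two
  have hprim_eq {c t : ℝ} (hac : a ≤ c) (hct : c ≤ t) (htb : t ≤ b) :=
    setIntegral_Ioo_eq_sub hint hac hct htb
  obtain ⟨c, ⟨hac, hcb⟩, hc, hle⟩ := exists_zero_forall_Icc_nonpos hab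
    (continuousOn_primitive_Icc hab hint) intervalIntegral.integral_same
    (by simpa [hprim_eq le_rfl hab le_rfl] using hmean)
  have hmemLp {α β : ℝ} (haα : a ≤ α) (hβb : β ≤ b) : MemLp ψ 2 (volume.restrict (Ioo α β)) :=
    hψ.mono_measure (Measure.restrict_mono_set _ (Ioo_subset_Ioo haα hβb))
  have hleft : ∫ t in Ioo a c, excess (ψ t) ≤ 0 := by
    rcases hac.eq_or_lt with rfl | hlt
    · simp
    · refine setIntegral_excess_nonpos_of_sq hac (hmemLp le_rfl hcb) (hsq a c le_rfl hlt hcb ?_)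
      rw [hprim_eq le_rfl hac hcb, hc, intervalIntegral.integral_same, sub_zero]
  have hright : ∫ t in Ioo c b, excess (ψ t) ≤ 0 := by
    refine setIntegral_excess_nonpos_of_primitive hcb (hmemLp hac le_rfl) (fun t ht => ?_)
      fun α β hcα hαβ hβb => hsq α β (hac.trans hcα) hαβ hβb
    rw [intervalIntegral.integral_of_le ht.1, integral_Ioc_eq_integral_Ioo,
      hprim_eq hac ht.1 ht.2, hc, sub_zero]
    exact hle t ht
  have hex : IntegrableOn (fun t => excess (ψ t)) (Ioo a b) := integrable_excess hψ
  linarith [setIntegral_Ioo_eq_sub hex le_rfl hab le_rfl, setIntegral_Ioo_eq_sub hex le_rfl hac hcb,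
    setIntegral_Ioo_eq_sub hex hac hcb le_rfl]

end RisingSun

section Moments

open ProbabilityTheory

variable {α : Type*} [MeasurableSpace α] {μ : Measure α} {X : α → ℝ}

/-- The `q`-th moment of `X`, normalised to be `1` for the standard exponential distribution. -/
noncomputable def normalizedMoment (μ : Measure α) (X : α → ℝ) (q : ℝ) : ℝ≥0∞ :=
  ∫⁻ x, ENNReal.ofReal (X x ^ q / Real.Gamma (q + 1)) ∂μ

/-- The integral of the amount by which `X` exceeds the level `c`. -/
noncomputable def tailMean (μ : Measure α) (X : α → ℝ) (c : ℝ) : ℝ :=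
  ∫ x, max (X x - c) 0 ∂μ

/-- Half the integral of the square of the amount by which `X` exceeds the level `c`. -/
noncomputable def tailSq (μ : Measure α) (X : α → ℝ) (c : ℝ) : ℝ :=
  ∫ x, max (X x - c) 0 ^ 2 / 2 ∂μ

theorem tailMean_nonneg (c : ℝ) : 0 ≤ tailMean μ X c :=
  integral_nonneg fun _ => le_max_right _ _

theorem tailSq_nonneg (c : ℝ) : 0 ≤ tailSq μ X c :=
  integral_nonneg fun _ => by positivity

theorem normalizedMoment_one (hX : Integrable X μ) (hX0 : ∀ x, 0 ≤ X x) :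
    normalizedMoment μ X 1 = ENNReal.ofReal (tailMean μ X 0) := by
  simp only [normalizedMoment, tailMean, sub_zero, max_eq_left (hX0 _), Real.rpow_one]
  rw [ofReal_integral_eq_lintegral_ofReal hX (ae_of_all _ hX0), one_add_one_eq_two,
    Real.Gamma_two]
  simp only [div_one]

theorem normalizedMoment_two (hX : MemLp X 2 μ) (hX0 : ∀ x, 0 ≤ X x) :
    normalizedMoment μ X 2 = ENNReal.ofReal (tailSq μ X 0) := by
  have hGamma : Real.Gamma (2 + 1) = 2 := by
    rw [Real.Gamma_add_one two_ne_zero, Real.Gamma_two, mul_one]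
  simp only [normalizedMoment, tailSq, sub_zero, max_eq_left (hX0 _), hGamma, Real.rpow_two]
  exact (ofReal_integral_eq_lintegral_ofReal (hX.integrable_sq.div_const 2)
    (ae_of_all _ fun x => by positivity)).symm

theorem hasDerivAt_max_zero_sq_div_two (x : ℝ) :
    HasDerivAt (fun y : ℝ => max y 0 ^ 2 / 2) (max x 0) x := by
  have hcont : Continuous fun y : ℝ => max y 0 := by fun_prop
  have hne : ∀ y ≠ (0 : ℝ), HasDerivAt (fun y : ℝ => max y 0 ^ 2 / 2) (max y 0) y := by
    intro y hy
    rcases hy.lt_or_gt with hy | hy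
    · rw [max_eq_right hy.le]
      refine (hasDerivAt_const y (0 : ℝ)).congr_of_eventuallyEq ?_
      filter_upwards [Iio_mem_nhds hy] with z hz
      simp [max_eq_right (mem_Iio.1 hz).le]
    · rw [max_eq_left hy.le]
      refine HasDerivAt.congr_of_eventuallyEq (f := fun z => z ^ 2 / 2) ?_ ?_
      · simpa using ((hasDerivAt_id y).pow 2).div_const 2
      · filter_upwards [Ioi_mem_nhds hy] with z hz
        rw [max_eq_left (mem_Ioi.1 hz).le]
  rcases eq_or_ne x 0 with rfl | hx
  · exact hasDerivAt_of_hasDerivAt_of_ne (g := fun y => max y 0) hne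
      ((hcont.pow 2).div_const 2).continuousAt hcont.continuousAt
  · exact hne x hx

theorem hasDerivAt_tailSq [IsFiniteMeasure μ] (hX : MemLp X 2 μ) (c : ℝ) :
    HasDerivAt (tailSq μ X) (-tailMean μ X c) c := by
  have hmem (d : ℝ) : MemLp (fun x => max (X x - d) 0) 2 μ := memLp_max_sub_zero hX d
  have hderiv : ∀ x, ∀ d ∈ Ioi (c - 1),
      HasDerivAt (fun d => max (X x - d) 0 ^ 2 / 2) (-max (X x - d) 0) d := fun x d _ =>
    (hasDerivAt_max_zero_sq_div_two (X x - d)).comp_const_sub (X x) d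
  have hbound : ∀ x, ∀ d ∈ Ioi (c - 1), ‖-max (X x - d) 0‖ ≤ max (X x - (c - 1)) 0 := by
    intro x d hd
    rw [norm_neg, Real.norm_of_nonneg (le_max_right _ _)]
    exact max_le_max_right 0 (sub_le_sub_left (mem_Ioi.1 hd).le _)
  unfold tailSq tailMean
  rw [← integral_neg]
  exact (hasDerivAt_integral_of_dominated_loc_of_deriv_le (Ioi_mem_nhds (sub_one_lt c))
    (Eventually.of_forall fun d => ((hmem d).integrable_sq.div_const 2).aestronglyMeasurable)
    ((hmem c).integrable_sq.div_const 2) (hmem c).aestronglyMeasurable.neg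
    (ae_of_all _ hbound) ((hmem _).integrable one_le_two) (ae_of_all _ hderiv)).2

theorem antitoneOn_exp_mul_tailSq [IsFiniteMeasure μ] (hX : MemLp X 2 μ)
    (hle : ∀ c, 0 ≤ c → tailSq μ X c ≤ tailMean μ X c) :
    AntitoneOn (fun c => Real.exp c * tailSq μ X c) (Ici 0) := by
  have hderiv (c : ℝ) : HasDerivAt (fun c => Real.exp c * tailSq μ X c)
      (Real.exp c * tailSq μ X c + Real.exp c * -tailMean μ X c) c :=
    (Real.hasDerivAt_exp c).mul (hasDerivAt_tailSq hX c)
  refine antitoneOn_of_deriv_nonpos (convex_Ici 0)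
    (fun c _ => (hderiv c).continuousAt.continuousWithinAt)
    (fun c _ => (hderiv c).differentiableAt.differentiableWithinAt) fun c hc => ?_
  rw [interior_Ici] at hc
  rw [(hderiv c).deriv, ← mul_add, ← sub_eq_add_neg]
  exact mul_nonpos_of_nonneg_of_nonpos (Real.exp_pos c).le (sub_nonpos.2 (hle c (mem_Ioi.1 hc).le))

theorem tailSq_le_exp_neg_mul [IsFiniteMeasure μ] (hX : MemLp X 2 μ)
    (hle : ∀ c, 0 ≤ c → tailSq μ X c ≤ tailMean μ X c) {c : ℝ} (hc : 0 ≤ c) :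
    tailSq μ X c ≤ Real.exp (-c) * tailSq μ X 0 := by
  have : Real.exp c * tailSq μ X c ≤ Real.exp 0 * tailSq μ X 0 :=
    antitoneOn_exp_mul_tailSq hX hle self_mem_Ici hc hc
  rw [Real.exp_zero, one_mul] at this
  rwa [Real.exp_neg, ← div_eq_inv_mul, le_div_iff₀' (Real.exp_pos c)]

/-- The density `c₊^(a-1) / Γ(a)` of the fractional integral of order `a`, normalised so that orders
add under convolution. -/
noncomputable def powerKernel (a : ℝ) : ℝ → ℝ≥0∞ :=
  (Ioi 0).indicator fun c => ENNReal.ofReal (c ^ (a - 1) / Real.Gamma a)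

theorem powerKernel_of_pos {a c : ℝ} (hc : 0 < c) :
    powerKernel a c = ENNReal.ofReal (c ^ (a - 1) / Real.Gamma a) :=
  indicator_of_mem (mem_Ioi.2 hc) _

theorem powerKernel_of_nonpos {a c : ℝ} (hc : c ≤ 0) : powerKernel a c = 0 :=
  indicator_of_notMem (notMem_Ioi.2 hc) _

theorem powerKernel_ne_top (a c : ℝ) : powerKernel a c ≠ ∞ := by
  unfold powerKernel indicator
  split_ifs
  exacts [ENNReal.ofReal_ne_top, ENNReal.zero_ne_top]

theorem measurable_powerKernel (a : ℝ) : Measurable (powerKernel a) :=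
  Measurable.indicator (by fun_prop) measurableSet_Ioi

theorem powerKernel_add_one {q x : ℝ} (hq : 0 < q) (hx : 0 ≤ x) :
    powerKernel (q + 1) x = ENNReal.ofReal (x ^ q / Real.Gamma (q + 1)) := by
  rcases hx.eq_or_lt with rfl | hx
  · rw [powerKernel_of_nonpos le_rfl, Real.zero_rpow hq.ne', zero_div, ENNReal.ofReal_zero]
  · rw [powerKernel_of_pos hx, add_sub_cancel_right]

theorem powerKernel_two (x : ℝ) : powerKernel 2 x = ENNReal.ofReal (max x 0) := by
  rcases le_or_gt x 0 with hx | hx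
  · rw [powerKernel_of_nonpos hx, max_eq_right hx, ENNReal.ofReal_zero]
  · rw [powerKernel_of_pos hx, max_eq_left hx.le, Real.Gamma_two, div_one,
      show (2 : ℝ) - 1 = 1 by norm_num, Real.rpow_one]

theorem powerKernel_three (x : ℝ) : powerKernel 3 x = ENNReal.ofReal (max x 0 ^ 2 / 2) := by
  have hGamma : Real.Gamma 3 = 2 := by
    rw [← two_add_one_eq_three, Real.Gamma_add_one two_ne_zero, Real.Gamma_two, mul_one]
  rcases le_or_gt x 0 with hx | hx
  · simp [powerKernel_of_nonpos hx, max_eq_right hx]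
  · rw [powerKernel_of_pos hx, max_eq_left hx.le, hGamma, show (3 : ℝ) - 1 = 2 by norm_num,
      Real.rpow_two]

theorem powerKernel_mul_powerKernel_sub_eq_betaPDF {a b x u : ℝ} (ha : 0 < a) (hb : 0 < b)
    (hx : 0 < x) : ENNReal.ofReal x * (powerKernel a (x * u) * powerKernel b (x - x * u)) =
      powerKernel (a + b) x * betaPDF a b u := by
  rw [show x - x * u = x * (1 - u) by ring]
  rcases le_or_gt u 0 with hu0 | hu0
  · rw [powerKernel_of_nonpos (mul_nonpos_of_nonneg_of_nonpos hx.le hu0),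
      betaPDF_eq_zero_of_nonpos hu0, zero_mul, mul_zero, mul_zero]
  rcases le_or_gt 1 u with hu1 | hu1
  · rw [powerKernel_of_nonpos (mul_nonpos_of_nonneg_of_nonpos hx.le (sub_nonpos.2 hu1)),
      betaPDF_eq_zero_of_one_le hu1, mul_zero, mul_zero, mul_zero]
  have hu1' : 0 < 1 - u := sub_pos.2 hu1
  have hpow : x ^ (a + b - 1) = x * (x ^ (a - 1) * x ^ (b - 1)) := by
    rw [show a + b - 1 = 1 + ((a - 1) + (b - 1)) by ring, Real.rpow_add hx, Real.rpow_add hx,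
      Real.rpow_one]
  rw [powerKernel_of_pos (mul_pos hx hu0), powerKernel_of_pos (mul_pos hx hu1'),
    powerKernel_of_pos hx, betaPDF_of_pos_lt_one hu0 hu1, Real.mul_rpow hx.le hu0.le,
    Real.mul_rpow hx.le hu1'.le, hpow, beta, ← ENNReal.ofReal_mul (by positivity),
    ← ENNReal.ofReal_mul hx.le, ← ENNReal.ofReal_mul (by positivity)]
  congr 1
  field_simp

theorem lintegral_powerKernel_mul_powerKernel_sub {a b : ℝ} (ha : 0 < a) (hb : 0 < b) (x : ℝ) :
    ∫⁻ c, powerKernel a c * powerKernel b (x - c) = powerKernel (a + b) x := by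
  rcases le_or_gt x 0 with hx | hx
  · rw [powerKernel_of_nonpos hx]
    refine lintegral_eq_zero_of_ae_eq_zero (ae_of_all _ fun c => ?_)
    rcases le_or_gt c 0 with hc | hc
    · simp [powerKernel_of_nonpos hc]
    · simp [powerKernel_of_nonpos (sub_nonpos.2 (hx.trans hc.le))]
  · have hscale : ∫⁻ c, powerKernel a c * powerKernel b (x - c) =
        ∫⁻ u, ENNReal.ofReal x * (powerKernel a (x * u) * powerKernel b (x - x * u)) := by
      have := lintegral_image_eq_lintegral_abs_deriv_mul (s := univ) (f := fun u => x * u)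
        MeasurableSet.univ (fun u _ => ((hasDerivAt_id u).const_mul x).hasDerivWithinAt)
        (mul_right_injective₀ hx.ne').injOn fun c => powerKernel a c * powerKernel b (x - c)
      simpa [(mul_left_surjective₀ hx.ne').range_eq, abs_of_pos hx] using this
    simp_rw [hscale, powerKernel_mul_powerKernel_sub_eq_betaPDF ha hb hx]
    rw [lintegral_const_mul' _ _ (powerKernel_ne_top _ _), lintegral_betaPDF_eq_one ha hb, mul_one]

theorem normalizedMoment_eq_lintegral_powerKernel [SFinite μ] (hX : AEMeasurable X μ)
    (hX0 : ∀ x, 0 ≤ X x) {a b : ℝ} (ha : 0 < a) (hb : 0 < b) (hab : 1 < a + b) :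
    normalizedMoment μ X (a + b - 1) =
      ∫⁻ c, powerKernel a c * ∫⁻ x, powerKernel b (X x - c) ∂μ := by
  have hmeas : AEMeasurable (fun z : α × ℝ => powerKernel a z.2 * powerKernel b (X z.1 - z.2))
      (μ.prod volume) :=
    ((measurable_powerKernel a).comp_aemeasurable measurable_snd.aemeasurable).mul
      ((measurable_powerKernel b).comp_aemeasurable (hX.comp_fst.sub measurable_snd.aemeasurable))
  calc normalizedMoment μ X (a + b - 1)
      = ∫⁻ x, (∫⁻ c, powerKernel a c * powerKernel b (X x - c)) ∂μ := by
        refine lintegral_congr fun x => ?_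
        rw [lintegral_powerKernel_mul_powerKernel_sub ha hb,
          ← powerKernel_add_one (by linarith) (hX0 x), sub_add_cancel]
    _ = ∫⁻ c, ∫⁻ x, powerKernel a c * powerKernel b (X x - c) ∂μ := lintegral_lintegral_swap hmeas
    _ = ∫⁻ c, powerKernel a c * ∫⁻ x, powerKernel b (X x - c) ∂μ :=
        lintegral_congr fun c => lintegral_const_mul' _ _ (powerKernel_ne_top _ _)

theorem lintegral_powerKernel_two_sub [IsFiniteMeasure μ] (hX : Integrable X μ) (c : ℝ) :
    ∫⁻ x, powerKernel 2 (X x - c) ∂μ = ENNReal.ofReal (tailMean μ X c) := by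
  simp_rw [powerKernel_two]
  exact (ofReal_integral_eq_lintegral_ofReal (hX.sub (integrable_const c)).pos_part
    (ae_of_all _ fun x => le_max_right _ _)).symm

theorem lintegral_powerKernel_three_sub [IsFiniteMeasure μ] (hX : MemLp X 2 μ) (c : ℝ) :
    ∫⁻ x, powerKernel 3 (X x - c) ∂μ = ENNReal.ofReal (tailSq μ X c) := by
  simp_rw [powerKernel_three]
  exact (ofReal_integral_eq_lintegral_ofReal ((memLp_max_sub_zero hX c).integrable_sq.div_const 2)
    (ae_of_all _ fun x => by positivity)).symm

theorem powerKernel_eq_gammaPDF_mul_exp (a : ℝ) {c : ℝ} (hc : c ≠ 0) :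
    powerKernel a c = gammaPDF a 1 c * ENNReal.ofReal (Real.exp c) := by
  rcases hc.lt_or_gt with hc | hc
  · rw [powerKernel_of_nonpos hc.le, gammaPDF_of_neg hc, zero_mul]
  · rw [powerKernel_of_pos hc, gammaPDF_of_nonneg hc.le, ← ENNReal.ofReal_mul' (Real.exp_pos c).le,
      Real.one_rpow, one_mul, mul_assoc, ← Real.exp_add, neg_add_cancel, Real.exp_zero, mul_one,
      div_mul_eq_mul_div, one_mul]

theorem normalizedMoment_eq_lintegral_gammaPDF [IsFiniteMeasure μ] (hX : MemLp X 2 μ)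
    (hX0 : ∀ x, 0 ≤ X x) {q : ℝ} (hq : 2 < q) :
    normalizedMoment μ X q =
      ∫⁻ c, gammaPDF (q - 2) 1 c * ENNReal.ofReal (Real.exp c * tailSq μ X c) := by
  have h := normalizedMoment_eq_lintegral_powerKernel hX.aestronglyMeasurable.aemeasurable hX0
    (sub_pos.2 hq) three_pos (by linarith)
  rw [show q - 2 + 3 - 1 = q by ring] at h
  rw [h]
  refine lintegral_congr_ae ?_
  filter_upwards [Measure.ae_ne volume 0] with c hc
  rw [lintegral_powerKernel_three_sub hX, powerKernel_eq_gammaPDF_mul_exp _ hc,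
    ENNReal.ofReal_mul (Real.exp_pos c).le, mul_assoc]

theorem mul_add_mul_le_of_le {a b c d : ℝ≥0∞} (hab : a ≤ b) (hcd : c ≤ d) :
    a * d + b * c ≤ a * c + b * d := by
  obtain ⟨e, rfl⟩ := le_iff_exists_add.1 hab
  calc a * d + (a + e) * c = a * d + a * c + e * c := by ring
    _ ≤ a * d + a * c + e * d := by gcongr
    _ = a * c + (a + e) * d := by ring

theorem lintegral_mul_le_of_single_crossing {f g h : α → ℝ≥0∞} {k : ℝ≥0∞} (hk : k ≠ ∞)
    (hf : Measurable f) (hg : Measurable g) (hfg : ∫⁻ x, f x ∂μ = ∫⁻ x, g x ∂μ)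
    (hfin : ∫⁻ x, f x ∂μ ≠ ∞)
    (hcross : ∀ᵐ x ∂μ, (f x ≤ g x ∧ k ≤ h x) ∨ (g x ≤ f x ∧ h x ≤ k)) :
    ∫⁻ x, f x * h x ∂μ ≤ ∫⁻ x, g x * h x ∂μ := by
  have hpointwise : ∀ᵐ x ∂μ, f x * h x + k * g x ≤ g x * h x + k * f x := by
    filter_upwards [hcross] with x hx
    rw [mul_comm k, mul_comm k, add_comm (g x * h x)]
    rcases hx with ⟨hfg, hkh⟩ | ⟨hgf, hhk⟩
    · exact mul_add_mul_le_of_le hfg hkh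
    · rw [add_comm, add_comm (f x * k)]
      exact mul_add_mul_le_of_le hgf hhk
  have hintegral := lintegral_mono_ae hpointwise
  rw [lintegral_add_right _ (hg.const_mul k), lintegral_add_right _ (hf.const_mul k),
    lintegral_const_mul _ hg, lintegral_const_mul _ hf, ← hfg] at hintegral
  exact (ENNReal.add_le_add_iff_right (ENNReal.mul_ne_top hk hfin)).1 hintegral

theorem gammaPDF_le_gammaPDF_iff {a b c : ℝ} (ha : 0 < a) (hab : a < b) (hc : 0 < c) :
    gammaPDF b 1 c ≤ gammaPDF a 1 c ↔
      c ≤ (Real.Gamma b / Real.Gamma a) ^ (1 / (b - a)) := by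
  have hGa := Real.Gamma_pos_of_pos ha
  have hGb := Real.Gamma_pos_of_pos (ha.trans hab)
  have hsub : 0 < b - a := sub_pos.2 hab
  have hpow : c ^ (b - 1) = c ^ (b - a) * c ^ (a - 1) := by
    rw [← Real.rpow_add hc]; ring_nf
  have hnonneg : 0 ≤ 1 ^ a / Real.Gamma a * c ^ (a - 1) * Real.exp (-(1 * c)) := by positivity
  rw [gammaPDF_of_nonneg hc.le, gammaPDF_of_nonneg hc.le, ENNReal.ofReal_le_ofReal_iff hnonneg,
    mul_le_mul_iff_left₀ (Real.exp_pos _), Real.one_rpow, Real.one_rpow, hpow, ← mul_assoc,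
    mul_le_mul_iff_left₀ (Real.rpow_pos_of_pos hc _), one_div (b - a),
    Real.le_rpow_inv_iff_of_pos hc.le (by positivity) hsub, one_div_mul_eq_div,
    div_le_div_iff₀ hGb hGa, le_div_iff₀ hGa, one_mul]

theorem lintegral_gammaPDF_mul_le {a b : ℝ} (ha : 0 < a) (hab : a < b) {h : ℝ → ℝ}
    (hh : AntitoneOn h (Ici 0)) :
    ∫⁻ c, gammaPDF b 1 c * ENNReal.ofReal (h c) ≤ ∫⁻ c, gammaPDF a 1 c * ENNReal.ofReal (h c) := by
  set c₀ := (Real.Gamma b / Real.Gamma a) ^ (1 / (b - a))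
  have hc₀ : 0 ≤ c₀ := Real.rpow_nonneg (div_nonneg
    (Real.Gamma_pos_of_pos (ha.trans hab)).le (Real.Gamma_pos_of_pos ha).le) _
  have hb := lintegral_gammaPDF_eq_one (ha.trans hab) one_pos
  refine lintegral_mul_le_of_single_crossing (k := ENNReal.ofReal (h c₀)) ENNReal.ofReal_ne_top
    (measurable_gammaPDFReal b 1).ennreal_ofReal (measurable_gammaPDFReal a 1).ennreal_ofReal
    (hb.trans (lintegral_gammaPDF_eq_one ha one_pos).symm) (hb ▸ ENNReal.one_ne_top) ?_
  filter_upwards [Measure.ae_ne volume 0] with c hc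
  rcases hc.lt_or_gt with hc | hc
  · rw [gammaPDF_of_neg hc, gammaPDF_of_neg hc]
    exact (le_total _ _).imp (⟨le_rfl, ·⟩) (⟨le_rfl, ·⟩)
  · have hiff := gammaPDF_le_gammaPDF_iff ha hab hc
    rcases le_or_gt c c₀ with hcc₀ | hcc₀
    · exact Or.inl ⟨hiff.2 hcc₀, ENNReal.ofReal_le_ofReal (hh hc.le hc₀ hcc₀)⟩
    · exact Or.inr ⟨(not_le.1 (mt hiff.1 hcc₀.not_ge)).le,
        ENNReal.ofReal_le_ofReal (hh hc₀ hc.le hcc₀.le)⟩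

theorem normalizedMoment_le_of_two_lt [IsFiniteMeasure μ] (hX : MemLp X 2 μ)
    (hX0 : ∀ x, 0 ≤ X x) (hle : ∀ c, 0 ≤ c → tailSq μ X c ≤ tailMean μ X c) {p r : ℝ}
    (hp : 2 < p) (hpr : p ≤ r) : normalizedMoment μ X r ≤ normalizedMoment μ X p := by
  rcases hpr.eq_or_lt with rfl | hpr
  · exact le_rfl
  rw [normalizedMoment_eq_lintegral_gammaPDF hX hX0 hp,
    normalizedMoment_eq_lintegral_gammaPDF hX hX0 (hp.trans hpr)]
  exact lintegral_gammaPDF_mul_le (sub_pos.2 hp) (sub_lt_sub_right hpr 2)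
    (antitoneOn_exp_mul_tailSq hX hle)

theorem normalizedMoment_le_tailSq_zero [IsFiniteMeasure μ] (hX : MemLp X 2 μ)
    (hX0 : ∀ x, 0 ≤ X x) (hle : ∀ c, 0 ≤ c → tailSq μ X c ≤ tailMean μ X c) {r : ℝ}
    (hr : 2 ≤ r) : normalizedMoment μ X r ≤ ENNReal.ofReal (tailSq μ X 0) := by
  rcases hr.eq_or_lt with rfl | hr
  · exact (normalizedMoment_two hX hX0).le
  rw [normalizedMoment_eq_lintegral_gammaPDF hX hX0 hr]
  calc ∫⁻ c, gammaPDF (r - 2) 1 c * ENNReal.ofReal (Real.exp c * tailSq μ X c)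
      ≤ ∫⁻ c, gammaPDF (r - 2) 1 c * ENNReal.ofReal (tailSq μ X 0) := by
        refine lintegral_mono fun c => ?_
        rcases lt_or_ge c 0 with hc | hc
        · simp [gammaPDF_of_neg hc]
        · gcongr
          simpa using antitoneOn_exp_mul_tailSq hX hle self_mem_Ici hc hc
    _ = ENNReal.ofReal (tailSq μ X 0) := by
        rw [lintegral_mul_const' _ _ ENNReal.ofReal_ne_top,
          lintegral_gammaPDF_eq_one (sub_pos.2 hr) one_pos, one_mul]

theorem setOf_lt_rpow_eq_Ioo {s t : ℝ} (hs : s < 0) (ht : 0 < t) :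
    {c : ℝ | t < c ^ s} ∩ Ioi 0 = Ioo 0 (t ^ s⁻¹) := by
  ext c
  rw [mem_inter_iff, mem_ofPred_eq, mem_Ioi, mem_Ioo, and_comm]
  refine and_congr_right fun hc => ?_
  exact (Real.lt_rpow_inv_iff_of_neg hc ht hs).symm

-- Layer cake: the superlevel sets of `c ^ s` with `s < 0` are the intervals `(0, y)`.
theorem lintegral_rpow_mul_le_of_Ioo {f g : ℝ → ℝ≥0∞} (hf : Measurable f) (hg : Measurable g)
    {s : ℝ} (hs : s < 0)
    (h : ∀ y, 0 < y → ∫⁻ c in Ioo 0 y, f c ≤ ∫⁻ c in Ioo 0 y, g c) :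
    ∫⁻ c in Ioi (0 : ℝ), ENNReal.ofReal (c ^ s) * f c ≤
      ∫⁻ c in Ioi (0 : ℝ), ENNReal.ofReal (c ^ s) * g c := by
  have hmeas : Measurable fun c : ℝ => c ^ s := by fun_prop
  have hlayer {f : ℝ → ℝ≥0∞} (hf : Measurable f) :
      ∫⁻ c in Ioi (0 : ℝ), ENNReal.ofReal (c ^ s) * f c =
        ∫⁻ t in Ioi (0 : ℝ), ∫⁻ c in Ioo 0 (t ^ s⁻¹), f c := by
    have hpos : 0 ≤ᵐ[(volume.restrict (Ioi 0)).withDensity f] fun c : ℝ => c ^ s :=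
      (withDensity_absolutelyContinuous _ _).ae_le <|
        (ae_restrict_mem measurableSet_Ioi).mono fun c hc => Real.rpow_nonneg (mem_Ioi.1 hc).le s
    have := lintegral_eq_lintegral_meas_lt _ hpos hmeas.aemeasurable
    rw [lintegral_withDensity_eq_lintegral_mul _ hf hmeas.ennreal_ofReal] at this
    simp only [Pi.mul_apply, mul_comm (f _)] at this
    rw [this]
    refine setLIntegral_congr_fun measurableSet_Ioi fun t ht => ?_
    rw [withDensity_apply _ (measurableSet_lt measurable_const hmeas),
      Measure.restrict_restrict (measurableSet_lt measurable_const hmeas),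
      setOf_lt_rpow_eq_Ioo hs ht]
  rw [hlayer hf, hlayer hg]
  exact setLIntegral_mono' measurableSet_Ioi fun t ht => h _ (Real.rpow_pos_of_pos ht _)

theorem lintegral_powerKernel_mul_le_of_Ioo {f g : ℝ → ℝ≥0∞} {a : ℝ} (ha : 0 < a) (ha1 : a < 1)
    (hf : Measurable f) (hg : Measurable g)
    (h : ∀ y, 0 < y → ∫⁻ c in Ioo 0 y, f c ≤ ∫⁻ c in Ioo 0 y, g c) :
    ∫⁻ c, powerKernel a c * f c ≤ ∫⁻ c, powerKernel a c * g c := by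
  have hkernel {f : ℝ → ℝ≥0∞} (hf : Measurable f) : ∫⁻ c, powerKernel a c * f c =
      ENNReal.ofReal (Real.Gamma a)⁻¹ *
        ∫⁻ c in Ioi (0 : ℝ), ENNReal.ofReal (c ^ (a - 1)) * f c := by
    rw [← lintegral_const_mul _ (by fun_prop), ← lintegral_indicator measurableSet_Ioi]
    refine lintegral_congr fun c => ?_
    rcases le_or_gt c 0 with hc | hc
    · rw [powerKernel_of_nonpos hc, zero_mul, indicator_of_notMem (notMem_Ioi.2 hc)]
    · rw [powerKernel_of_pos hc, indicator_of_mem (mem_Ioi.2 hc), ← mul_assoc,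
        ← ENNReal.ofReal_mul (inv_nonneg.2 (Real.Gamma_pos_of_pos ha).le), div_eq_inv_mul]
  rw [hkernel hf, hkernel hg]
  exact mul_le_mul_right (lintegral_rpow_mul_le_of_Ioo hf hg (sub_neg.2 ha1) h) _

theorem lintegral_Ioo_of_hasDerivAt_neg {F f : ℝ → ℝ} {a b : ℝ} (hab : a ≤ b)
    (hF : ∀ c, HasDerivAt F (-f c) c) (hf : ∀ c, 0 ≤ f c) :
    ∫⁻ c in Ioo a b, ENNReal.ofReal (f c) = ENNReal.ofReal (F a - F b) := by
  have hderiv : ∀ c, HasDerivAt (fun c => -F c) (f c) c := fun c => by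
    simpa using (hF c).fun_neg
  have hint : IntervalIntegrable f volume a b :=
    intervalIntegral.intervalIntegrable_deriv_of_nonneg
      (fun c _ => (hderiv c).continuousAt.continuousWithinAt) (fun c _ => hderiv c) fun c _ => hf c
  rw [← ofReal_integral_eq_lintegral_ofReal
      ((intervalIntegrable_iff_integrableOn_Ioo_of_le hab).1 hint) (ae_of_all _ hf),
    ← integral_Ioc_eq_integral_Ioo, ← intervalIntegral.integral_of_le hab,
    intervalIntegral.integral_eq_sub_of_hasDerivAt (fun c _ => hderiv c) hint, neg_sub_neg]

theorem lintegral_Ioo_exp_neg_mul_le_tailMean [IsFiniteMeasure μ] (hX : MemLp X 2 μ)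
    (hle : ∀ c, 0 ≤ c → tailSq μ X c ≤ tailMean μ X c) {y : ℝ} (hy : 0 ≤ y) :
    ∫⁻ c in Ioo 0 y, ENNReal.ofReal (Real.exp (-c) * tailSq μ X 0) ≤
      ∫⁻ c in Ioo 0 y, ENNReal.ofReal (tailMean μ X c) := by
  have hexp (c : ℝ) : HasDerivAt (fun c => Real.exp (-c) * tailSq μ X 0)
      (-(Real.exp (-c) * tailSq μ X 0)) c := by
    simpa using ((hasDerivAt_neg c).exp).mul_const (tailSq μ X 0)
  rw [lintegral_Ioo_of_hasDerivAt_neg hy hexp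
      fun c => mul_nonneg (Real.exp_pos _).le (tailSq_nonneg 0),
    lintegral_Ioo_of_hasDerivAt_neg hy (hasDerivAt_tailSq hX) tailMean_nonneg]
  refine ENNReal.ofReal_le_ofReal ?_
  rw [neg_zero, Real.exp_zero, one_mul]
  exact sub_le_sub_left (tailSq_le_exp_neg_mul hX hle hy) _

theorem antitone_tailMean [IsFiniteMeasure μ] (hX : Integrable X μ) : Antitone (tailMean μ X) :=
  fun _ _ hst => integral_mono (hX.sub (integrable_const _)).pos_part
    (hX.sub (integrable_const _)).pos_part fun _ => max_le_max_right 0 (sub_le_sub_left hst _)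

theorem tailSq_zero_le_normalizedMoment [IsFiniteMeasure μ] (hX : MemLp X 2 μ)
    (hX0 : ∀ x, 0 ≤ X x) (hle : ∀ c, 0 ≤ c → tailSq μ X c ≤ tailMean μ X c) {p : ℝ}
    (hp : 1 ≤ p) (hp2 : p < 2) :
    ENNReal.ofReal (tailSq μ X 0) ≤ normalizedMoment μ X p := by
  have hint : Integrable X μ := hX.integrable one_le_two
  rcases hp.eq_or_lt with rfl | hp
  · rw [normalizedMoment_one hint hX0]
    exact ENNReal.ofReal_le_ofReal (hle 0 le_rfl)
  have hp1 : 0 < p - 1 := sub_pos.2 hp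
  have hmoment := normalizedMoment_eq_lintegral_powerKernel (b := 2)
    hint.aestronglyMeasurable.aemeasurable hX0 hp1 two_pos (by linarith)
  simp_rw [sub_add_eq_add_sub, lintegral_powerKernel_two_sub hint] at hmoment
  rw [show p + 2 - 1 - 1 = p by ring] at hmoment
  calc ENNReal.ofReal (tailSq μ X 0)
      = ∫⁻ c, powerKernel (p - 1) c * ENNReal.ofReal (Real.exp (-c) * tailSq μ X 0) := ?_
    _ ≤ ∫⁻ c, powerKernel (p - 1) c * ENNReal.ofReal (tailMean μ X c) :=
      lintegral_powerKernel_mul_le_of_Ioo hp1 (by linarith) (by fun_prop)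
        (antitone_tailMean hint).measurable.ennreal_ofReal fun y hy =>
          lintegral_Ioo_exp_neg_mul_le_tailMean hX hle hy.le
    _ = normalizedMoment μ X p := hmoment.symm
  rw [← one_mul (ENNReal.ofReal _), ← lintegral_gammaPDF_eq_one hp1 one_pos,
    ← lintegral_mul_const' _ _ ENNReal.ofReal_ne_top]
  refine lintegral_congr_ae ?_
  filter_upwards [Measure.ae_ne volume 0] with c hc
  rw [powerKernel_eq_gammaPDF_mul_exp _ hc, mul_assoc, ← ENNReal.ofReal_mul (Real.exp_pos c).le,
    ← mul_assoc, ← Real.exp_add, add_neg_cancel, Real.exp_zero, one_mul]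

theorem normalizedMoment_le [IsFiniteMeasure μ] (hX : MemLp X 2 μ) (hX0 : ∀ x, 0 ≤ X x)
    (hle : ∀ c, 0 ≤ c → tailSq μ X c ≤ tailMean μ X c) {p r : ℝ} (hp : 1 ≤ p)
    (hr : max 2 p ≤ r) : normalizedMoment μ X r ≤ normalizedMoment μ X p := by
  have hupper := normalizedMoment_le_tailSq_zero hX hX0 hle ((le_max_left _ _).trans hr)
  rcases lt_trichotomy p 2 with hp2 | rfl | hp2
  · exact hupper.trans (tailSq_zero_le_normalizedMoment hX hX0 hle hp hp2)
  · exact hupper.trans_eq (normalizedMoment_two hX hX0).symm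
  · exact normalizedMoment_le_of_two_lt hX hX0 hle hp2 ((le_max_right _ _).trans hr)

end Moments

section BMO

variable {φ ψ : ℝ → ℝ} {I : Set ℝ} {a b : ℝ}

theorem isBoundedInterval_Ioo (hab : a < b) : IsBoundedInterval (Ioo a b) :=
  ⟨ordConnected_Ioo, Metric.isBounded_Ioo a b, by rwa [interior_Ioo, nonempty_Ioo]⟩

theorem IsBoundedInterval.exists_Ioo_subset (hI : IsBoundedInterval I) :
    ∃ a b, a < b ∧ Ioo a b ⊆ I ∧ I ⊆ Icc a b := by
  obtain ⟨hconn, hbdd, hne⟩ := hI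
  have hIcc := subset_Icc_csInf_csSup hbdd.bddBelow hbdd.bddAbove
  refine ⟨sInf I, sSup I, ?_, IsConnected.Ioo_csInf_csSup_subset
    ⟨hne.mono interior_subset, hconn.isPreconnected⟩ hbdd.bddBelow hbdd.bddAbove, hIcc⟩
  rw [← nonempty_Ioo, ← interior_Icc]
  exact hne.mono (interior_mono hIcc)

theorem restrict_eq_restrict_Ioo (hsub : Ioo a b ⊆ I) (hsup : I ⊆ Icc a b) :
    volume.restrict I = volume.restrict (Ioo a b) :=
  Measure.restrict_congr_set <|
    (hsup.eventuallyLE.trans Ioo_ae_eq_Icc.symm.le).antisymm hsub.eventuallyLE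

theorem bmoSeminorm_le_iff {C : ℝ≥0∞} : bmoSeminorm φ I ≤ C ↔ ∀ α β, α < β → Ioo α β ⊆ I →
    ⨍⁻ t in Ioo α β, ‖φ t - ⨍ s in Ioo α β, φ s‖ₑ ^ 2 ∂volume ≤ C ^ 2 := by
  rw [bmoSeminorm, one_div, ENNReal.rpow_inv_le_iff two_pos, ENNReal.rpow_two, iSup₂_le_iff]
  constructor
  · exact fun h α β hαβ hsub => h _ ⟨isBoundedInterval_Ioo hαβ, hsub⟩
  · rintro h J ⟨hJ, hJI⟩
    obtain ⟨α, β, hαβ, hsub, hsup⟩ := hJ.exists_Ioo_subset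
    rw [restrict_eq_restrict_Ioo hsub hsup]
    exact h α β hαβ (hsub.trans hJI)

theorem bmoSeminorm_eq_bmoSeminorm_Ioo (hsub : Ioo a b ⊆ I) (hsup : I ⊆ Icc a b) :
    bmoSeminorm φ I = bmoSeminorm φ (Ioo a b) := by
  have hIoo (α β : ℝ) : Ioo α β ⊆ I ↔ Ioo α β ⊆ Ioo a b := by
    refine ⟨fun h => ?_, fun h => h.trans hsub⟩
    rw [← interior_Icc (a := a)]
    exact interior_maximal (h.trans hsup) isOpen_Ioo
  refine eq_of_forall_ge_iff fun C => ?_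
  simp only [bmoSeminorm_le_iff, hIoo]

theorem IsBoundedInterval.exists_Ioo (hI : IsBoundedInterval I) :
    ∃ a b, a < b ∧ volume.restrict I = volume.restrict (Ioo a b) ∧
      ∀ φ, bmoSeminorm φ I = bmoSeminorm φ (Ioo a b) := by
  obtain ⟨a, b, hab, hsub, hsup⟩ := hI.exists_Ioo_subset
  exact ⟨a, b, hab, restrict_eq_restrict_Ioo hsub hsup,
    fun φ => bmoSeminorm_eq_bmoSeminorm_Ioo hsub hsup⟩

theorem lintegral_enorm_sq_eq {α : Type*} [MeasurableSpace α] {μ : Measure α} {f : α → ℝ}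
    (hf : MemLp f 2 μ) : ∫⁻ x, ‖f x‖ₑ ^ 2 ∂μ = ENNReal.ofReal (∫ x, f x ^ 2 ∂μ) := by
  rw [ofReal_integral_eq_lintegral_ofReal hf.integrable_sq (ae_of_all _ fun x => sq_nonneg _)]
  refine lintegral_congr fun x => ?_
  rw [← sq_abs, ENNReal.ofReal_pow (abs_nonneg _), Real.enorm_eq_ofReal_abs]

theorem setLAverage_enorm_sq_le_one_iff (hab : a < b)
    (hψ : MemLp ψ 2 (volume.restrict (Ioo a b))) :
    ⨍⁻ t in Ioo a b, ‖ψ t‖ₑ ^ 2 ∂volume ≤ 1 ↔ ∫ t in Ioo a b, ψ t ^ 2 ≤ b - a := by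
  have hba := sub_pos.2 hab
  rw [setLAverage_eq, lintegral_enorm_sq_eq hψ, Real.volume_Ioo,
    ENNReal.div_le_iff (by simpa using hab) ENNReal.ofReal_ne_top, one_mul,
    ENNReal.ofReal_le_ofReal_iff hba.le]

theorem bmoSeminorm_le_one_iff (hφ : MemLp φ 2 (volume.restrict (Ioo a b))) :
    bmoSeminorm φ (Ioo a b) ≤ 1 ↔ ∀ α β, a ≤ α → α < β → β ≤ b →
      ∫ t in Ioo α β, (φ t - ⨍ s in Ioo α β, φ s) ^ 2 ≤ β - α := by
  have hiff (α β : ℝ) (hα : a ≤ α) (hαβ : α < β) (hβ : β ≤ b) := by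
    have hmono : MemLp φ 2 (volume.restrict (Ioo α β)) :=
      hφ.mono_measure (Measure.restrict_mono (Ioo_subset_Ioo hα hβ) le_rfl)
    exact setLAverage_enorm_sq_le_one_iff hαβ (hmono.sub (memLp_const (⨍ s in Ioo α β, φ s)))
  rw [bmoSeminorm_le_iff, one_pow]
  refine forall₂_congr fun α β => ⟨fun h hα hαβ hβ => ?_, fun h hαβ hsub => ?_⟩
  · exact (hiff α β hα hαβ hβ).1 (h hαβ (Ioo_subset_Ioo hα hβ))
  · obtain ⟨hα, hβ⟩ := (Ioo_subset_Ioo_iff hαβ).1 hsub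
    exact (hiff α β hα hαβ hβ).2 (h hα hαβ hβ)

theorem bmoSeminorm_const_mul_add_le (hφ : IntegrableOn φ I) (l d : ℝ) :
    bmoSeminorm (fun t => l * φ t + d) I ≤ ‖l‖ₑ * bmoSeminorm φ I := by
  refine bmoSeminorm_le_iff.2 fun α β hαβ hsub => ?_
  have haverage : ⨍ s in Ioo α β, (l * φ s + d) = l * (⨍ s in Ioo α β, φ s) + d := by
    rw [setAverage_eq, setAverage_eq,
      integral_add ((hφ.mono_set hsub).const_mul l) (integrable_const d), integral_const_mul,
      integral_const, measureReal_restrict_apply_univ, Real.volume_real_Ioo_of_le hαβ.le]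
    have := (sub_pos.2 hαβ).ne'
    simp only [smul_eq_mul]
    field_simp
  calc ⨍⁻ t in Ioo α β, ‖l * φ t + d - ⨍ s in Ioo α β, (l * φ s + d)‖ₑ ^ 2 ∂volume
      = ⨍⁻ t in Ioo α β, ‖l‖ₑ ^ 2 * ‖φ t - ⨍ s in Ioo α β, φ s‖ₑ ^ 2 ∂volume := by
        simp only [haverage, add_sub_add_right_eq_sub, ← mul_sub, enorm_mul, mul_pow]
    _ = ‖l‖ₑ ^ 2 * ⨍⁻ t in Ioo α β, ‖φ t - ⨍ s in Ioo α β, φ s‖ₑ ^ 2 ∂volume :=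
        lintegral_const_mul' _ _ (by finiteness)
    _ ≤ ‖l‖ₑ ^ 2 * bmoSeminorm φ I ^ 2 := by
        gcongr
        exact bmoSeminorm_le_iff.1 le_rfl α β hαβ hsub
    _ = (‖l‖ₑ * bmoSeminorm φ I) ^ 2 := (mul_pow _ _ _).symm

theorem setIntegral_excess_nonpos_of_bmoSeminorm_le_one (hab : a ≤ b)
    (hψ : MemLp ψ 2 (volume.restrict (Ioo a b))) (hmean : ∫ t in Ioo a b, ψ t ≤ 0)
    (hbmo : bmoSeminorm ψ (Ioo a b) ≤ 1) : ∫ t in Ioo a b, excess (ψ t) ≤ 0 := by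
  refine setIntegral_excess_nonpos hab hψ hmean fun α β hα hαβ hβ hzero => ?_
  have haverage : ⨍ s in Ioo α β, ψ s = 0 := by rw [setAverage_eq, hzero, smul_zero]
  simpa only [haverage, sub_zero] using (bmoSeminorm_le_one_iff hψ).1 hbmo α β hα hαβ hβ

theorem excess_sub_add_excess_neg_sub {c : ℝ} (hc : 0 ≤ c) (y : ℝ) :
    excess (y - (c + 1)) + excess (-y - (c + 1)) = max (|y| - c) 0 ^ 2 / 2 - max (|y| - c) 0 := by
  unfold excess
  rw [show y - (c + 1) + 1 = y - c by ring, show -y - (c + 1) + 1 = -y - c by ring]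
  rcases le_total 0 y with h | h
  · rw [abs_of_nonneg h, max_eq_right (show -y - c ≤ 0 by linarith)]; ring
  · rw [abs_of_nonpos h, max_eq_right (show y - c ≤ 0 by linarith)]; ring

theorem tailSq_abs_le_tailMean_abs (hab : a ≤ b) (hφ : MemLp φ 2 (volume.restrict (Ioo a b)))
    (hmean : ∫ t in Ioo a b, φ t = 0) (hbmo : bmoSeminorm φ (Ioo a b) ≤ 1) {c : ℝ}
    (hc : 0 ≤ c) :
    tailSq (volume.restrict (Ioo a b)) (fun t => |φ t|) c ≤
      tailMean (volume.restrict (Ioo a b)) (fun t => |φ t|) c := by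
  have hint : IntegrableOn φ (Ioo a b) := hφ.integrable one_le_two
  have hmemLp (l : ℝ) : MemLp (fun t => l * φ t - (c + 1)) 2 (volume.restrict (Ioo a b)) :=
    (hφ.const_mul l).sub (memLp_const _)
  have hexcess (l : ℝ) (hl : ‖l‖ₑ = 1) : ∫ t in Ioo a b, excess (l * φ t - (c + 1)) ≤ 0 := by
    refine setIntegral_excess_nonpos_of_bmoSeminorm_le_one hab (hmemLp l) ?_ ?_
    · rw [integral_sub (hint.const_mul l) (integrable_const _), integral_const_mul, hmean,
        mul_zero, zero_sub, integral_const, smul_eq_mul]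
      exact neg_nonpos.2 (by positivity)
    · simpa only [hl, one_mul, ← sub_eq_add_neg] using
        (bmoSeminorm_const_mul_add_le hint l (-(c + 1))).trans (mul_le_mul_right hbmo ‖l‖ₑ)
  have hplus := hexcess 1 (by simp)
  have hminus := hexcess (-1) (by simp)
  have habs : MemLp (fun t => max (|φ t| - c) 0) 2 (volume.restrict (Ioo a b)) :=
    memLp_max_sub_zero hφ.abs c
  rw [← sub_nonpos, tailSq, tailMean,
    ← integral_sub (habs.integrable_sq.div_const 2) (habs.integrable one_le_two)]
  simp_rw [← excess_sub_add_excess_neg_sub hc]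
  have hint_plus := integrable_excess (hmemLp 1)
  have hint_minus := integrable_excess (hmemLp (-1))
  simp only [one_mul, neg_one_mul] at hplus hminus hint_plus hint_minus
  rw [integral_add hint_plus hint_minus]
  exact add_nonpos hplus hminus

theorem normalizedMoment_abs_le (hI : IsBoundedInterval I) (hφ : MemLp φ 2 (volume.restrict I))
    (hmean : ∫ t in I, φ t = 0) (hbmo : bmoSeminorm φ I ≤ 1) {p r : ℝ} (hp : 1 ≤ p)
    (hr : max 2 p ≤ r) :
    normalizedMoment (volume.restrict I) (fun t => |φ t|) r ≤
      normalizedMoment (volume.restrict I) (fun t => |φ t|) p := by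
  obtain ⟨a, b, hab, hrestrict, hseminorm⟩ := hI.exists_Ioo
  rw [hrestrict] at hφ hmean ⊢
  rw [hseminorm] at hbmo
  exact normalizedMoment_le hφ.abs (fun _ => abs_nonneg _)
    (fun _ hc => tailSq_abs_le_tailMean_abs hab.le hφ hmean hbmo hc) hp hr

theorem lpNormOn_eq {q : ℝ} (hq : 0 < q) (φ : ℝ → ℝ) (I : Set ℝ) :
    lpNormOn φ q I = (ENNReal.ofReal (Real.Gamma (q + 1)) *
      normalizedMoment (volume.restrict I) (fun t => |φ t|) q) ^ (1 / q) := by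
  have hΓ : 0 < Real.Gamma (q + 1) := Real.Gamma_pos_of_pos (by linarith)
  rw [lpNormOn, eLpNorm_eq_lintegral_rpow_enorm_toReal (by simpa using hq)
    ENNReal.ofReal_ne_top, ENNReal.toReal_ofReal hq.le, normalizedMoment,
    ← lintegral_const_mul' _ _ ENNReal.ofReal_ne_top]
  congr 1
  refine lintegral_congr fun t => ?_
  rw [← ENNReal.ofReal_mul hΓ.le, mul_div_cancel₀ _ hΓ.ne', Real.enorm_eq_ofReal_abs,
    ENNReal.ofReal_rpow_of_nonneg (abs_nonneg _) hq.le]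

theorem multConst_mul_lpNormOn_rpow {p r : ℝ} (hp : 0 < p) (hr : 0 < r) (φ : ℝ → ℝ)
    (I : Set ℝ) :
    ENNReal.ofReal (multConst p r) * lpNormOn φ p I ^ (p / r) =
      (ENNReal.ofReal (Real.Gamma (r + 1)) *
        normalizedMoment (volume.restrict I) (fun t => |φ t|) p) ^ (1 / r) := by
  have hΓp : 0 < Real.Gamma (p + 1) := Real.Gamma_pos_of_pos (by linarith)
  have hΓr : 0 < Real.Gamma (r + 1) := Real.Gamma_pos_of_pos (by linarith)
  rw [lpNormOn_eq hp, ← ENNReal.rpow_mul, one_div_mul_eq_div, div_div_cancel_left' hp.ne',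
    ← one_div, multConst, ← ENNReal.ofReal_rpow_of_pos (div_pos hΓr hΓp),
    ← ENNReal.mul_rpow_of_nonneg _ _ (one_div_nonneg.2 hr.le), ← mul_assoc,
    ← ENNReal.ofReal_mul (div_pos hΓr hΓp).le, div_mul_cancel₀ _ hΓp.ne']

theorem lpNormOn_const_mul (c q : ℝ) (φ : ℝ → ℝ) (I : Set ℝ) :
    lpNormOn (fun t => c * φ t) q I = ‖c‖ₑ * lpNormOn φ q I :=
  eLpNorm_const_smul c φ (ENNReal.ofReal q) (volume.restrict I)

theorem lpNormOn_le_of_bmoSeminorm_le_one (hI : IsBoundedInterval I)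
    (hφ : MemLp φ 2 (volume.restrict I)) (hmean : ∫ t in I, φ t = 0)
    (hbmo : bmoSeminorm φ I ≤ 1) {p r : ℝ} (hp : 1 ≤ p) (hr : max 2 p ≤ r) :
    lpNormOn φ r I ≤ ENNReal.ofReal (multConst p r) * lpNormOn φ p I ^ (p / r) := by
  have hp0 : 0 < p := one_pos.trans_le hp
  have hr0 : 0 < r := two_pos.trans_le ((le_max_left 2 p).trans hr)
  rw [lpNormOn_eq hr0, multConst_mul_lpNormOn_rpow hp0 hr0]
  gcongr
  exact normalizedMoment_abs_le hI hφ hmean hbmo hp hr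

theorem setLIntegral_sub_average_le (hI : IsBoundedInterval I) (φ : ℝ → ℝ) :
    ∫⁻ t in I, ‖φ t - ⨍ s in I, φ s‖ₑ ^ 2 ≤ volume I * bmoSeminorm φ I ^ 2 := by
  obtain ⟨a, b, hab, hrestrict, hseminorm⟩ := hI.exists_Ioo
  rw [hseminorm, ← Measure.restrict_apply_univ, hrestrict, ← measure_mul_laverage]
  gcongr
  exact bmoSeminorm_le_iff.1 le_rfl a b hab subset_rfl

theorem MemBMO.memLp_two (hI : IsBoundedInterval I) (hφ : MemBMO φ I) :
    MemLp φ 2 (volume.restrict I) := by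
  have hvol : volume I < ∞ := hI.2.1.measure_lt_top
  have : IsFiniteMeasure (volume.restrict I) := isFiniteMeasure_restrict.2 hvol.ne
  have hsub : MemLp (fun t => φ t - ⨍ s in I, φ s) 2 (volume.restrict I) := by
    refine ⟨hφ.1.aestronglyMeasurable.sub aestronglyMeasurable_const, ?_⟩
    rw [eLpNorm_lt_top_iff_lintegral_rpow_enorm_lt_top two_ne_zero ENNReal.ofNat_ne_top]
    simpa using (setLIntegral_sub_average_le hI φ).trans_lt
      (ENNReal.mul_lt_top hvol (ENNReal.pow_lt_top hφ.2))
  simpa [Pi.add_def] using hsub.add (memLp_const (⨍ s in I, φ s))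

theorem MemBMO.ae_eq_average (hI : IsBoundedInterval I) (hφ : MemBMO φ I)
    (hzero : bmoSeminorm φ I = 0) : φ =ᵐ[volume.restrict I] fun _ => ⨍ s in I, φ s := by
  have hint := setLIntegral_sub_average_le hI φ
  rw [hzero, zero_pow two_ne_zero, mul_zero, nonpos_iff_eq_zero, lintegral_eq_zero_iff'
    ((hφ.1.aestronglyMeasurable.aemeasurable.sub_const _).enorm.pow_const 2)] at hint
  filter_upwards [hint] with t ht
  simpa [sub_eq_zero] using ht

theorem MemBMO.lpNormOn_le (hI : IsBoundedInterval I) (hφ : MemBMO φ I)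
    (hmean : ⨍ t in I, φ t = 0) {p r : ℝ} (hp : 1 ≤ p) (hr : max 2 p ≤ r) :
    lpNormOn φ r I ≤ ENNReal.ofReal (multConst p r) *
      lpNormOn φ p I ^ (p / r) * bmoSeminorm φ I ^ (1 - p / r) := by
  rcases eq_or_ne (bmoSeminorm φ I) 0 with hzero | hne
  · have hae := hφ.ae_eq_average hI hzero
    rw [lpNormOn, eLpNorm_congr_ae hae, hmean]
    simp
  set N := bmoSeminorm φ I with hN
  have hvol : volume I ≠ ∞ := hI.2.1.measure_lt_top.ne
  have hr0 : 0 < r := two_pos.trans_le ((le_max_left 2 p).trans hr)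
  have henorm : ‖N.toReal⁻¹‖ₑ = N⁻¹ := by
    rw [Real.enorm_of_nonneg (by positivity), ← ENNReal.toReal_inv,
      ENNReal.ofReal_toReal (ENNReal.inv_ne_top.2 hne)]
  have hbmo : bmoSeminorm (fun t => N.toReal⁻¹ * φ t) I ≤ 1 := by
    simpa [henorm, ← hN, ENNReal.inv_mul_cancel hne hφ.2.ne] using
      bmoSeminorm_const_mul_add_le hφ.1 N.toReal⁻¹ 0
  have hmean' : ∫ t in I, N.toReal⁻¹ * φ t = 0 := by
    rw [integral_const_mul, ← measure_smul_setAverage φ hvol, hmean, smul_zero, mul_zero]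
  have hscaled := lpNormOn_le_of_bmoSeminorm_le_one hI ((hφ.memLp_two hI).const_mul N.toReal⁻¹)
    hmean' hbmo hp hr
  rw [lpNormOn_const_mul, lpNormOn_const_mul, henorm,
    ENNReal.mul_rpow_of_nonneg _ _ (by positivity)] at hscaled
  calc lpNormOn φ r I = N * (N⁻¹ * lpNormOn φ r I) := by
        rw [← mul_assoc, ENNReal.mul_inv_cancel hne hφ.2.ne, one_mul]
    _ ≤ N * (ENNReal.ofReal (multConst p r) * (N⁻¹ ^ (p / r) * lpNormOn φ p I ^ (p / r))) := by
        gcongr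
    _ = ENNReal.ofReal (multConst p r) * lpNormOn φ p I ^ (p / r) * N ^ (1 - p / r) := by
        rw [ENNReal.rpow_sub _ _ hne hφ.2.ne, ENNReal.rpow_one, ENNReal.inv_rpow, div_eq_mul_inv N]
        ring

theorem MemBMO.memLp (hI : IsBoundedInterval I) (hφ : MemBMO φ I) (hmean : ⨍ t in I, φ t = 0)
    {r : ℝ} (hr : 2 ≤ r) : MemLp φ (ENNReal.ofReal r) (volume.restrict I) := by
  have hr0 : 0 < r := two_pos.trans_le hr
  have htwo : lpNormOn φ 2 I ≠ ∞ := by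
    simpa [lpNormOn] using (hφ.memLp_two hI).eLpNorm_ne_top
  refine ⟨hφ.1.aestronglyMeasurable,
    (hφ.lpNormOn_le hI hmean one_le_two (by simpa using hr)).trans_lt ?_⟩
  refine ENNReal.mul_lt_top (ENNReal.mul_lt_top ENNReal.ofReal_lt_top ?_) ?_
  · exact ENNReal.rpow_lt_top_of_nonneg (by positivity) htwo
  · exact ENNReal.rpow_lt_top_of_nonneg (sub_nonneg.2 ((div_le_one hr0).2 hr)) hφ.2.ne

end BMO

section ExponentialTail

open ProbabilityTheory

theorem setLIntegral_Ioi_gammaPDF {a r : ℝ} (ha : 0 < a) (hr : 0 < r) :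
    ∫⁻ t in Ioi 0, gammaPDF a r t = 1 := by
  rw [← lintegral_gammaPDF_eq_one ha hr,
    ← lintegral_add_compl (μ := volume) (gammaPDF a r) (measurableSet_Ioi (a := 0)), compl_Ioi,
    ← restrict_Iio_eq_restrict_Iic, lintegral_gammaPDF_of_nonpos le_rfl, add_zero]

theorem normalizedMoment_eq_of_measure_lt_eq_exp {α : Type*} [MeasurableSpace α] {μ : Measure α}
    {X : α → ℝ} (hX : AEMeasurable X μ) (hX0 : ∀ x, 0 ≤ X x) {A : ℝ≥0∞}
    (htail : ∀ t > 0, μ {x | t < X x} = A * ENNReal.ofReal (Real.exp (-t))) {q : ℝ}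
    (hq : 0 < q) : normalizedMoment μ X q = A := by
  have hdensity : ∀ t ∈ Ioi (0 : ℝ),
      ENNReal.ofReal (q / Real.Gamma (q + 1)) *
        (μ {x | t < X x} * ENNReal.ofReal (t ^ (q - 1))) = A * gammaPDF q 1 t := by
    intro t (ht : 0 < t)
    rw [htail t ht, gammaPDF_of_nonneg ht.le, mul_assoc, mul_left_comm,
      ← ENNReal.ofReal_mul (Real.exp_nonneg _), ← ENNReal.ofReal_mul (by positivity),
      Real.Gamma_add_one hq.ne']
    congr 2
    simp only [Real.one_rpow, one_mul]
    field_simp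
  have hsplit (x : α) : ENNReal.ofReal (X x ^ q / Real.Gamma (q + 1)) =
      ENNReal.ofReal (Real.Gamma (q + 1))⁻¹ * ENNReal.ofReal (X x ^ q) := by
    rw [← ENNReal.ofReal_mul (inv_nonneg.2 (Real.Gamma_nonneg_of_nonneg (by positivity))),
      inv_mul_eq_div]
  calc normalizedMoment μ X q
      = ∫⁻ t in Ioi 0, A * gammaPDF q 1 t := by
        simp only [normalizedMoment, hsplit]
        rw [lintegral_const_mul' _ _ ENNReal.ofReal_ne_top,
          lintegral_rpow_eq_lintegral_meas_lt_mul μ (ae_of_all _ hX0) hX hq, ← mul_assoc,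
          ← ENNReal.ofReal_mul (inv_nonneg.2 (Real.Gamma_nonneg_of_nonneg (by positivity))),
          inv_mul_eq_div, ← lintegral_const_mul' _ _ ENNReal.ofReal_ne_top]
        exact setLIntegral_congr_fun measurableSet_Ioi hdensity
    _ = A * ∫⁻ t in Ioi 0, gammaPDF q 1 t :=
        lintegral_const_mul _ (measurable_gammaPDFReal q 1).ennreal_ofReal
    _ = A := by rw [setLIntegral_Ioi_gammaPDF hq one_pos, mul_one]

end ExponentialTail

section AffineInvariance

variable {κ d a b : ℝ}

theorem setLIntegral_comp_affine (hκ : 0 < κ) (d a b : ℝ) (g : ℝ → ℝ≥0∞) :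
    ENNReal.ofReal κ * ∫⁻ t in Ioo a b, g (κ * t + d) =
      ∫⁻ s in Ioo (κ * a + d) (κ * b + d), g s := by
  rw [← image_affine_Ioo hκ, lintegral_image_eq_lintegral_abs_deriv_mul measurableSet_Ioo
    (f' := fun _ => κ) (fun t _ => ?_) (fun s _ t _ h => by simpa [hκ.ne'] using h),
    abs_of_pos hκ, lintegral_const_mul' _ _ ENNReal.ofReal_ne_top]
  simpa using (((hasDerivAt_id t).const_mul κ).add_const d).hasDerivWithinAt

theorem volume_Ioo_affine (hκ : 0 < κ) (d a b : ℝ) :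
    volume (Ioo (κ * a + d) (κ * b + d)) = ENNReal.ofReal κ * volume (Ioo a b) := by
  rw [Real.volume_Ioo, Real.volume_Ioo, ← ENNReal.ofReal_mul hκ.le]
  congr 1
  ring

theorem setLAverage_comp_affine (hκ : 0 < κ) (d a b : ℝ) (g : ℝ → ℝ≥0∞) :
    ⨍⁻ t in Ioo a b, g (κ * t + d) ∂volume =
      ⨍⁻ s in Ioo (κ * a + d) (κ * b + d), g s ∂volume := by
  rw [setLAverage_eq, setLAverage_eq, ← setLIntegral_comp_affine hκ, volume_Ioo_affine hκ,
    ENNReal.mul_div_mul_left _ _ (by simpa using hκ) ENNReal.ofReal_ne_top]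

theorem setAverage_comp_affine (hκ : 0 < κ) (d : ℝ) (hab : a ≤ b) (f : ℝ → ℝ) :
    ⨍ t in Ioo a b, f (κ * t + d) = ⨍ s in Ioo (κ * a + d) (κ * b + d), f s := by
  have hab' : κ * a + d ≤ κ * b + d := by gcongr
  rw [setAverage_eq, setAverage_eq, ← integral_Ioc_eq_integral_Ioo,
    ← integral_Ioc_eq_integral_Ioo, ← intervalIntegral.integral_of_le hab,
    ← intervalIntegral.integral_of_le hab', intervalIntegral.integral_comp_mul_add _ hκ.ne',
    Real.volume_real_Ioo_of_le hab, Real.volume_real_Ioo_of_le hab', add_sub_add_right_eq_sub,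
    ← mul_sub, mul_inv_rev, mul_smul]

theorem bmoSeminorm_comp_affine_le (hκ : 0 < κ) (d a b : ℝ) (φ : ℝ → ℝ) :
    bmoSeminorm (fun t => φ (κ * t + d)) (Ioo a b) ≤
      bmoSeminorm φ (Ioo (κ * a + d) (κ * b + d)) := by
  refine bmoSeminorm_le_iff.2 fun α β hαβ hsub => ?_
  obtain ⟨hα, hβ⟩ := (Ioo_subset_Ioo_iff hαβ).1 hsub
  rw [setAverage_comp_affine hκ d hαβ.le,
    setLAverage_comp_affine hκ d α β fun s => ‖φ s - ⨍ u in Ioo (κ * α + d) (κ * β + d), φ u‖ₑ ^ 2]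
  exact bmoSeminorm_le_iff.1 le_rfl _ _ (by gcongr) (Ioo_subset_Ioo (by gcongr) (by gcongr))

theorem integrableOn_comp_affine (hκ : 0 < κ) {φ : ℝ → ℝ}
    (hφ : IntegrableOn φ (Ioo (κ * a + d) (κ * b + d))) :
    IntegrableOn (fun t => φ (κ * t + d)) (Ioo a b) := by
  rw [← image_affine_Ioo hκ, integrableOn_image_iff_integrableOn_abs_deriv_smul measurableSet_Ioo
    (f' := fun _ => κ) (fun t _ => ?_) (fun s _ t _ h => by simpa [hκ.ne'] using h)] at hφ
  · exact (integrable_smul_iff (abs_pos.2 hκ.ne').ne' _).1 hφ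
  · simpa using (((hasDerivAt_id t).const_mul κ).add_const d).hasDerivWithinAt

end AffineInvariance

section PhiZero

theorem measurable_phiZero : Measurable phiZero := by
  unfold phiZero
  exact Measurable.ite measurableSet_Ici (by fun_prop)
    (Measurable.ite measurableSet_Ici (by fun_prop) (by fun_prop))

theorem phiZero_eq_zero {t : ℝ} (ht : t ∈ Icc (-1) 1) : phiZero t = 0 := by
  rcases ht.2.eq_or_lt with rfl | hlt
  · norm_num [phiZero]
  · rw [phiZero, if_neg hlt.not_ge, if_pos ht.1]

theorem phiZero_of_one_le {t : ℝ} (ht : 1 ≤ t) : phiZero t = -Real.log (2 - t) :=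
  if_pos ht

theorem phiZero_neg (t : ℝ) : phiZero (-t) = -phiZero t := by
  wlog ht : 0 ≤ t generalizing t
  · rw [← neg_neg t, this (-t) (by linarith), neg_neg, neg_neg]
  rcases le_or_gt t 1 with h | h
  · rw [phiZero_eq_zero ⟨by linarith, h⟩, phiZero_eq_zero ⟨by linarith, by linarith⟩, neg_zero]
  · rw [phiZero_of_one_le h.le, neg_neg, phiZero, if_neg (by linarith), if_neg (by linarith),
      neg_add_eq_sub]

theorem lt_abs_phiZero_iff {s t : ℝ} (hs : 0 < s) (ht : t ∈ Ioo (-2) 2) :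
    s < |phiZero t| ↔ 2 - Real.exp (-s) < |t| := by
  wlog ht0 : 0 ≤ t generalizing t
  · rw [← abs_neg (phiZero t), ← phiZero_neg, ← abs_neg t]
    exact this ⟨by linarith [ht.2], by linarith [ht.1]⟩ (by linarith)
  have hexp : Real.exp (-s) < 1 := Real.exp_lt_one_iff.2 (by linarith)
  rw [abs_of_nonneg ht0]
  rcases le_or_gt t 1 with h | h
  · rw [phiZero_eq_zero ⟨by linarith, h⟩, abs_zero]
    constructor <;> intro <;> linarith
  · have hpos : 0 < 2 - t := by linarith [ht.2]
    rw [phiZero_of_one_le h.le, abs_neg, abs_of_nonpos (Real.log_nonpos hpos.le (by linarith)),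
      lt_neg, Real.log_lt_iff_lt_exp hpos, sub_lt_comm]

theorem volume_restrict_lt_abs_phiZero {s : ℝ} (hs : 0 < s) :
    volume.restrict (Ioo (-2) 2) {t | s < |phiZero t|} = 2 * ENNReal.ofReal (Real.exp (-s)) := by
  have hexp : Real.exp (-s) < 1 := Real.exp_lt_one_iff.2 (by linarith)
  have hset : {t | s < |phiZero t|} ∩ Ioo (-2) 2 =
      Ioo (-2) 2 \ Icc (-(2 - Real.exp (-s))) (2 - Real.exp (-s)) := by
    ext t
    rw [mem_inter_iff, mem_ofPred_eq, and_comm, Set.mem_sdiff, mem_Icc, ← abs_le, not_le]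
    exact and_congr_right fun ht => lt_abs_phiZero_iff hs ht
  have hsub : Icc (-(2 - Real.exp (-s))) (2 - Real.exp (-s)) ⊆ Ioo (-2) 2 :=
    Icc_subset_Ioo (by linarith [Real.exp_pos (-s)]) (by linarith [Real.exp_pos (-s)])
  rw [Measure.restrict_apply' measurableSet_Ioo, hset,
    measure_sdiff hsub measurableSet_Icc.nullMeasurableSet measure_Icc_lt_top.ne,
    Real.volume_Ioo, Real.volume_Icc, ← ENNReal.ofReal_sub _ (by linarith),
    ← ENNReal.ofReal_ofNat, ← ENNReal.ofReal_mul zero_le_two]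
  congr 1
  ring

theorem normalizedMoment_abs_phiZero {q : ℝ} (hq : 0 < q) :
    normalizedMoment (volume.restrict (Ioo (-2) 2)) (fun t => |phiZero t|) q = 2 :=
  normalizedMoment_eq_of_measure_lt_eq_exp measurable_phiZero.abs.aemeasurable
    (fun _ => abs_nonneg _) (fun _ hs => volume_restrict_lt_abs_phiZero hs) hq

theorem memLp_two_phiZero : MemLp phiZero 2 (volume.restrict (Ioo (-2) 2)) := by
  refine ⟨measurable_phiZero.aestronglyMeasurable, ?_⟩
  have hnorm := lpNormOn_eq two_pos phiZero (Ioo (-2) 2)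
  rw [normalizedMoment_abs_phiZero two_pos, lpNormOn, ENNReal.ofReal_ofNat] at hnorm
  rw [hnorm]
  finiteness

theorem intervalIntegrable_phiZero_sub_sq {α β : ℝ} (hα : -2 ≤ α) (hαβ : α ≤ β) (hβ : β ≤ 2)
    (k : ℝ) : IntervalIntegrable (fun t => (phiZero t - k) ^ 2) volume α β := by
  rw [intervalIntegrable_iff_integrableOn_Ioo_of_le hαβ]
  exact ((memLp_two_phiZero.sub (memLp_const k)).integrable_sq).mono_measure
    (Measure.restrict_mono (Ioo_subset_Ioo hα hβ) le_rfl)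

theorem setAverage_phiZero : ⨍ t in Ioo (-2) 2, phiZero t = 0 := by
  have hodd : ∫ t in (-2)..2, phiZero t = -∫ t in (-2)..2, phiZero t := by
    simpa [phiZero_neg] using (intervalIntegral.integral_comp_neg phiZero (a := -2) (b := 2)).symm
  rw [setAverage_eq, ← integral_Ioc_eq_integral_Ioo,
    ← intervalIntegral.integral_of_le (by norm_num), self_eq_neg.1 hodd, smul_zero]

theorem continuous_mul_log_sq : Continuous fun u : ℝ => u * Real.log u ^ 2 := by
  have hsqrt : Continuous fun u : ℝ => 4 * (√|u| * Real.log √|u|) ^ 2 :=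
    ((Real.continuous_mul_log.comp (Real.continuous_sqrt.comp continuous_abs)).pow 2).const_mul 4
  have habs (u : ℝ) : |u * Real.log u ^ 2| = 4 * (√|u| * Real.log √|u|) ^ 2 := by
    rw [Real.log_sqrt (abs_nonneg u), Real.log_abs, mul_pow, Real.sq_sqrt (abs_nonneg u), abs_mul,
      abs_of_nonneg (sq_nonneg (Real.log u))]
    ring
  rw [continuous_iff_continuousAt]
  intro u
  rcases eq_or_ne u 0 with rfl | hu
  · rw [ContinuousAt, zero_mul, tendsto_zero_iff_abs_tendsto_zero]
    simpa [Function.comp_def, habs] using hsqrt.tendsto 0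
  · have := Real.continuousAt_log hu
    fun_prop

theorem continuous_mul_log_add_sq (k : ℝ) :
    Continuous fun u : ℝ => u * (Real.log u + k) ^ 2 := by
  have hexpand (u : ℝ) : u * (Real.log u + k) ^ 2 =
      u * Real.log u ^ 2 + 2 * k * (u * Real.log u) + k ^ 2 * u := by ring
  simp only [hexpand]
  exact (continuous_mul_log_sq.add (Real.continuous_mul_log.const_mul _)).add (by fun_prop)

theorem hasDerivAt_mul_log_add_sq (k : ℝ) {u : ℝ} (hu : u ≠ 0) :
    HasDerivAt (fun u : ℝ => u * (Real.log u + k) ^ 2) ((Real.log u + k + 1) ^ 2 - 1) u := by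
  refine ((hasDerivAt_id u).mul (((Real.hasDerivAt_log hu).add_const k).pow 2)).congr_deriv ?_
  simp only [id_eq, Pi.pow_apply]
  field_simp
  ring

theorem integral_log_add_sq {x y : ℝ} (hx : 0 ≤ x) (hxy : x ≤ y) (k : ℝ) :
    ∫ u in x..y, (Real.log u + k) ^ 2 =
      y * (Real.log y + k - 1) ^ 2 - x * (Real.log x + k - 1) ^ 2 + (y - x) := by
  have hcont : ContinuousOn (fun u : ℝ => u * (Real.log u + (k - 1)) ^ 2 + u) (Icc x y) :=
    ((continuous_mul_log_add_sq _).add continuous_id).continuousOn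
  have hderiv : ∀ u ∈ Ioo x y, HasDerivAt (fun u : ℝ => u * (Real.log u + (k - 1)) ^ 2 + u)
      ((Real.log u + k) ^ 2) u := fun u hu =>
    ((hasDerivAt_mul_log_add_sq (k - 1) (hx.trans_lt hu.1).ne').add (hasDerivAt_id u)).congr_deriv
      (by ring)
  have hint := (intervalIntegrable_iff_integrableOn_Ioc_of_le hxy).2
    (intervalIntegral.integrableOn_deriv_of_nonneg hcont hderiv fun _ _ => sq_nonneg _)
  rw [intervalIntegral.integral_eq_sub_of_hasDerivAt_of_le hxy hcont hderiv hint]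
  ring

theorem integral_phiZero_sub_sq_of_one_le {α β : ℝ} (hα : 1 ≤ α) (hαβ : α ≤ β) (k : ℝ) :
    ∫ t in α..β, (phiZero t - k) ^ 2 = ∫ u in (2 - β)..(2 - α), (Real.log u + k) ^ 2 := by
  rw [← intervalIntegral.integral_comp_sub_left]
  refine intervalIntegral.integral_congr fun t ht => ?_
  rw [uIcc_of_le hαβ] at ht
  simp only [phiZero_of_one_le (hα.trans ht.1)]
  ring

theorem integral_phiZero_sub_sq_of_le_one {α β : ℝ} (hα : -1 ≤ α) (hαβ : α ≤ β) (hβ : β ≤ 1)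
    (k : ℝ) : ∫ t in α..β, (phiZero t - k) ^ 2 = k ^ 2 * (β - α) := by
  have hconst : ∫ t in α..β, (phiZero t - k) ^ 2 = ∫ _ in α..β, k ^ 2 := by
    refine intervalIntegral.integral_congr fun t ht => ?_
    rw [uIcc_of_le hαβ] at ht
    simp only [phiZero_eq_zero ⟨hα.trans ht.1, ht.2.trans hβ⟩, zero_sub, neg_sq]
  rw [hconst, intervalIntegral.integral_const, smul_eq_mul, mul_comm]

theorem integral_phiZero_sub_sq_le {α β : ℝ} (hα : -1 ≤ α) (hα1 : α ≤ 1) (hβ1 : 1 ≤ β)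
    (hβ : β ≤ 2) (k : ℝ) :
    ∫ t in α..β, (phiZero t - k) ^ 2 ≤ k ^ 2 * (1 - α) + (k - 1) ^ 2 + (β - 1) := by
  rw [← intervalIntegral.integral_add_adjacent_intervals
    (intervalIntegrable_phiZero_sub_sq (by linarith) hα1 (by norm_num) k)
    (intervalIntegrable_phiZero_sub_sq (by norm_num) hβ1 hβ k),
    integral_phiZero_sub_sq_of_le_one hα hα1 le_rfl,
    integral_phiZero_sub_sq_of_one_le le_rfl hβ1,
    integral_log_add_sq (by linarith) (by linarith)]
  have hnonneg : 0 ≤ (2 - β) * (Real.log (2 - β) + k - 1) ^ 2 :=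
    mul_nonneg (by linarith) (sq_nonneg _)
  norm_num
  linarith

theorem integral_phiZero_sq_le {β : ℝ} (hβ0 : 0 ≤ β) (hβ : β ≤ 2) :
    ∫ t in 0..β, phiZero t ^ 2 ≤ β := by
  rcases le_total β 1 with h | h
  · have hzero := integral_phiZero_sub_sq_of_le_one (by norm_num) hβ0 h 0
    simp only [sub_zero] at hzero
    linarith
  · have hle := integral_phiZero_sub_sq_le (by norm_num) zero_le_one h hβ 0
    simp only [sub_zero] at hle
    linarith

theorem exists_integral_phiZero_sub_sq_le_of_nonneg {α β : ℝ} (hα : 0 ≤ α) (hαβ : α ≤ β)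
    (hβ : β ≤ 2) : ∃ k, ∫ t in α..β, (phiZero t - k) ^ 2 ≤ β - α := by
  rcases le_total 1 α with hα1 | hα1
  · refine ⟨1 - Real.log (2 - α), ?_⟩
    rw [integral_phiZero_sub_sq_of_one_le hα1 hαβ, integral_log_add_sq (by linarith) (by linarith)]
    have hnonneg : 0 ≤ (2 - β) * (Real.log (2 - β) + (1 - Real.log (2 - α)) - 1) ^ 2 :=
      mul_nonneg (by linarith) (sq_nonneg _)
    simp only [add_sub_cancel, sub_self, zero_pow two_ne_zero, mul_zero]
    linarith
  refine ⟨1, ?_⟩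
  rcases le_total β 1 with hβ1 | hβ1
  · rw [integral_phiZero_sub_sq_of_le_one (by linarith) hαβ hβ1]
    linarith
  · linarith [integral_phiZero_sub_sq_le (by linarith) hα1 hβ1 hβ 1]

theorem exists_integral_phiZero_sub_sq_le {α β : ℝ} (hα : -2 ≤ α) (hαβ : α ≤ β) (hβ : β ≤ 2) :
    ∃ k, ∫ t in α..β, (phiZero t - k) ^ 2 ≤ β - α := by
  have hreflect (α β k : ℝ) :
      ∫ t in α..β, (phiZero t - k) ^ 2 = ∫ t in (-β)..(-α), (phiZero t - -k) ^ 2 := by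
    rw [← intervalIntegral.integral_comp_neg]
    refine intervalIntegral.integral_congr fun t _ => ?_
    simp only [phiZero_neg]
    ring
  rcases le_total 0 α with hα0 | hα0
  · exact exists_integral_phiZero_sub_sq_le_of_nonneg hα0 hαβ hβ
  rcases le_total 0 β with hβ0 | hβ0
  · refine ⟨0, ?_⟩
    rw [← intervalIntegral.integral_add_adjacent_intervals
      (intervalIntegrable_phiZero_sub_sq hα hα0 (by norm_num) 0)
      (intervalIntegrable_phiZero_sub_sq (by norm_num) hβ0 hβ 0), hreflect α]
    simp only [neg_zero, sub_zero]
    linarith [integral_phiZero_sq_le hβ0 hβ, integral_phiZero_sq_le (β := -α) (by linarith)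
      (by linarith)]
  · obtain ⟨k, hk⟩ := exists_integral_phiZero_sub_sq_le_of_nonneg (α := -β) (β := -α)
      (by linarith) (by linarith) (by linarith)
    refine ⟨-k, ?_⟩
    rw [hreflect, neg_neg]
    linarith

end PhiZero

section Extremal

variable {ψ : ℝ → ℝ} {I : Set ℝ} {a b : ℝ}

theorem integral_sub_average_sq_le {α : Type*} [MeasurableSpace α] {μ : Measure α}
    [IsFiniteMeasure μ] {f : α → ℝ} (hf : MemLp f 2 μ) (k : ℝ) :
    ∫ x, (f x - ⨍ y, f y ∂μ) ^ 2 ∂μ ≤ ∫ x, (f x - k) ^ 2 ∂μ := by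
  set m := ⨍ y, f y ∂μ with hm
  have hdev : MemLp (fun x => f x - m) 2 μ := hf.sub (memLp_const m)
  have hcross : ∫ x, 2 * (m - k) * (f x - m) ∂μ = 0 := by
    rw [integral_const_mul, hm, integral_sub_average, mul_zero]
  calc ∫ x, (f x - m) ^ 2 ∂μ
      = ∫ x, ((f x - m) ^ 2 + 2 * (m - k) * (f x - m)) ∂μ := by
        rw [integral_add hdev.integrable_sq ((hdev.integrable one_le_two).const_mul _), hcross,
          add_zero]
    _ ≤ ∫ x, (f x - k) ^ 2 ∂μ := by
        refine integral_mono (hdev.integrable_sq.add ((hdev.integrable one_le_two).const_mul _))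
          (hf.sub (memLp_const k)).integrable_sq fun x => ?_
        nlinarith [sq_nonneg (m - k)]

theorem bmoSeminorm_le_one_of_forall_exists {φ : ℝ → ℝ}
    (hφ : MemLp φ 2 (volume.restrict (Ioo a b)))
    (h : ∀ α β, a ≤ α → α < β → β ≤ b → ∃ k, ∫ t in α..β, (φ t - k) ^ 2 ≤ β - α) :
    bmoSeminorm φ (Ioo a b) ≤ 1 := by
  refine (bmoSeminorm_le_one_iff hφ).2 fun α β hα hαβ hβ => ?_
  obtain ⟨k, hk⟩ := h α β hα hαβ hβ
  rw [intervalIntegral.integral_of_le hαβ.le, integral_Ioc_eq_integral_Ioo] at hk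
  have hmono : MemLp φ 2 (volume.restrict (Ioo α β)) :=
    hφ.mono_measure (Measure.restrict_mono (Ioo_subset_Ioo hα hβ) le_rfl)
  exact (integral_sub_average_sq_le hmono k).trans hk

/-- A mean-zero function of `BMO(I)` with seminorm at most `1` all of whose normalised absolute
moments agree. Such a function turns the inequality between the `L^r` and `L^p` norms into an
equality, for all exponents at once; the common value `|I| / 2` is that of `phiZero`. -/
structure IsExtremal (ψ : ℝ → ℝ) (I : Set ℝ) : Prop where
  memBMO : MemBMO ψ I
  average_eq_zero : ⨍ t in I, ψ t = 0
  bmoSeminorm_le_one : bmoSeminorm ψ I ≤ 1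
  normalizedMoment_eq : ∀ q > 0,
    normalizedMoment (volume.restrict I) (fun t => |ψ t|) q = volume I / 2

theorem isExtremal_phiZero : IsExtremal phiZero (Ioo (-2) 2) := by
  have hbmo : bmoSeminorm phiZero (Ioo (-2) 2) ≤ 1 :=
    bmoSeminorm_le_one_of_forall_exists memLp_two_phiZero fun _ _ hα hαβ hβ =>
      exists_integral_phiZero_sub_sq_le hα hαβ.le hβ
  refine ⟨⟨memLp_two_phiZero.integrable one_le_two, hbmo.trans_lt ENNReal.one_lt_top⟩,
    setAverage_phiZero, hbmo, fun q hq => ?_⟩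
  rw [normalizedMoment_abs_phiZero hq, Real.volume_Ioo, ← ENNReal.ofReal_ofNat,
    ← ENNReal.ofReal_div_of_pos two_pos]
  norm_num

theorem IsExtremal.comp_affine {κ d : ℝ} (hκ : 0 < κ) (hab : a ≤ b)
    (h : IsExtremal ψ (Ioo (κ * a + d) (κ * b + d))) :
    IsExtremal (fun t => ψ (κ * t + d)) (Ioo a b) := by
  have hbmo := (bmoSeminorm_comp_affine_le hκ d a b ψ).trans h.bmoSeminorm_le_one
  refine ⟨⟨integrableOn_comp_affine hκ h.memBMO.1, hbmo.trans_lt ENNReal.one_lt_top⟩, ?_, hbmo,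
    fun q hq => ?_⟩
  · rw [setAverage_comp_affine hκ d hab, h.average_eq_zero]
  · have hmoment := h.normalizedMoment_eq q hq
    rw [normalizedMoment, ← setLIntegral_comp_affine hκ, volume_Ioo_affine hκ, mul_div_assoc]
      at hmoment
    exact (ENNReal.mul_right_inj (by simpa using hκ) ENNReal.ofReal_ne_top).1 hmoment

theorem IsBoundedInterval.exists_isExtremal (hI : IsBoundedInterval I) :
    ∃ ψ, IsExtremal ψ I := by
  obtain ⟨a, b, hab, hrestrict, hseminorm⟩ := hI.exists_Ioo
  have hba : 0 < b - a := sub_pos.2 hab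
  have hleft : 4 / (b - a) * a + -2 * (a + b) / (b - a) = -2 := by field_simp; ring
  have hright : 4 / (b - a) * b + -2 * (a + b) / (b - a) = 2 := by field_simp; ring
  obtain ⟨⟨hint, hbmo⟩, hmean, hone, hmoment⟩ :=
    IsExtremal.comp_affine (a := a) (b := b) (div_pos four_pos hba) hab.le
      (by rw [hleft, hright]; exact isExtremal_phiZero)
  have hvolume : volume I = volume (Ioo a b) := by
    rw [← Measure.restrict_apply_univ I, hrestrict, Measure.restrict_apply_univ]
  refine ⟨fun t => phiZero (4 / (b - a) * t + -2 * (a + b) / (b - a)), ⟨?_, ?_⟩, ?_, ?_,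
    fun q hq => ?_⟩
  · rwa [IntegrableOn, hrestrict]
  · rwa [hseminorm]
  · rwa [hrestrict]
  · rwa [hseminorm]
  · rw [hrestrict, hvolume, hmoment q hq]

theorem IsExtremal.lpNormOn_eq_multConst_mul {p r : ℝ} (h : IsExtremal ψ I) (hp : 0 < p)
    (hr : 0 < r) :
    lpNormOn ψ r I = ENNReal.ofReal (multConst p r) * lpNormOn ψ p I ^ (p / r) := by
  rw [lpNormOn_eq hr, multConst_mul_lpNormOn_rpow hp hr, h.normalizedMoment_eq r hr,
    h.normalizedMoment_eq p hp]

theorem IsExtremal.lpNormOn_pos {q : ℝ} (hI : IsBoundedInterval I) (h : IsExtremal ψ I)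
    (hq : 0 < q) : 0 < lpNormOn ψ q I := by
  have hvolume : 0 < volume I := Measure.measure_pos_of_nonempty_interior volume hI.2.2
  rw [lpNormOn_eq hq, h.normalizedMoment_eq q hq]
  refine ENNReal.rpow_pos_of_nonneg (ENNReal.mul_pos ?_ ?_) (by positivity)
  · simpa using Real.Gamma_pos_of_pos (by linarith : 0 < q + 1)
  · exact (ENNReal.div_pos hvolume.ne' ENNReal.ofNat_ne_top).ne'

theorem IsExtremal.lpNormOn_ne_top {q : ℝ} (hI : IsBoundedInterval I) (h : IsExtremal ψ I)
    (hq : 0 < q) : lpNormOn ψ q I ≠ ∞ := by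
  have hvolume : volume I ≠ ∞ := hI.2.1.measure_lt_top.ne
  rw [lpNormOn_eq hq, h.normalizedMoment_eq q hq]
  finiteness

theorem mul_bmoSeminorm_rpow_le {s : ℝ} (h : bmoSeminorm ψ I ≤ 1) (hs : 0 ≤ s) (c : ℝ≥0∞) :
    c * bmoSeminorm ψ I ^ s ≤ c :=
  mul_le_of_le_one_right' (ENNReal.rpow_le_one h hs)

theorem multConst_pos {p r : ℝ} (hp : 0 < p) (hr : 0 < r) : 0 < multConst p r :=
  Real.rpow_pos_of_pos (div_pos (Real.Gamma_pos_of_pos (by linarith))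
    (Real.Gamma_pos_of_pos (by linarith))) _

theorem IsExtremal.multConst_le {p r C : ℝ} (hI : IsBoundedInterval I) (h : IsExtremal ψ I)
    (hp : 0 < p) (hr : 0 < r) (hpr : p ≤ r)
    (hC : lpNormOn ψ r I ≤
      ENNReal.ofReal C * lpNormOn ψ p I ^ (p / r) * bmoSeminorm ψ I ^ (1 - p / r)) :
    multConst p r ≤ C := by
  have hnorm_pos : lpNormOn ψ p I ^ (p / r) ≠ 0 :=
    (ENNReal.rpow_pos (h.lpNormOn_pos hI hp) (h.lpNormOn_ne_top hI hp)).ne'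
  have hnorm_ne_top : lpNormOn ψ p I ^ (p / r) ≠ ∞ :=
    ENNReal.rpow_ne_top_of_nonneg (by positivity) (h.lpNormOn_ne_top hI hp)
  have hle := hC.trans (mul_bmoSeminorm_rpow_le h.bmoSeminorm_le_one
    (sub_nonneg.2 ((div_le_one hr).2 hpr)) _)
  rw [h.lpNormOn_eq_multConst_mul hp hr, ENNReal.mul_le_mul_iff_left hnorm_pos hnorm_ne_top,
    ENNReal.ofReal_le_ofReal_iff'] at hle
  exact hle.resolve_right (multConst_pos hp hr).not_ge

end Extremal

end

theorem theorem1 (p r : ℝ) (hp : 1 ≤ p) (hr : max 2 p ≤ r) :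
    -- the inequality, on every interval, for every mean-zero function of class BMO
    (∀ I : Set ℝ, IsBoundedInterval I → ∀ φ : ℝ → ℝ, MemBMO φ I → (⨍ t in I, φ t) = 0 →
      MemLp φ (ENNReal.ofReal r) (volume.restrict I) ∧
      lpNormOn φ r I ≤ ENNReal.ofReal (multConst p r) *
        lpNormOn φ p I ^ (p / r) * bmoSeminorm φ I ^ (1 - p / r)) ∧
    -- sharpness: on no interval can the constant be replaced by a smaller one
    (∀ I : Set ℝ, IsBoundedInterval I → ∀ C : ℝ,
      (∀ φ : ℝ → ℝ, MemBMO φ I → (⨍ t in I, φ t) = 0 →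
        lpNormOn φ r I ≤ ENNReal.ofReal C *
          lpNormOn φ p I ^ (p / r) * bmoSeminorm φ I ^ (1 - p / r)) →
      multConst p r ≤ C) ∧
    -- the explicit nonzero function on `(-2, 2)` for which equality holds
    (MemBMO phiZero (Set.Ioo (-2) 2) ∧
      (⨍ t in Set.Ioo (-2 : ℝ) 2, phiZero t) = 0 ∧
      0 < lpNormOn phiZero r (Set.Ioo (-2) 2) ∧
      lpNormOn phiZero r (Set.Ioo (-2) 2) = ENNReal.ofReal (multConst p r) *
        lpNormOn phiZero p (Set.Ioo (-2) 2) ^ (p / r) *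
        bmoSeminorm phiZero (Set.Ioo (-2) 2) ^ (1 - p / r)) := by
  have hp0 : 0 < p := by linarith
  have hr2 : 2 ≤ r := (le_max_left 2 p).trans hr
  have hr0 : 0 < r := by linarith
  have hpr : p ≤ r := (le_max_right 2 p).trans hr
  have hexponent : 0 ≤ 1 - p / r := sub_nonneg.2 ((div_le_one hr0).2 hpr)
  refine ⟨fun I hI φ hφ hmean => ⟨hφ.memLp hI hmean hr2, hφ.lpNormOn_le hI hmean hp hr⟩,
    fun I hI C hC => ?_, ?_⟩
  · obtain ⟨ψ, hψ⟩ := hI.exists_isExtremal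
    exact hψ.multConst_le hI hp0 hr0 hpr (hC ψ hψ.memBMO hψ.average_eq_zero)
  · have hI : IsBoundedInterval (Set.Ioo (-2) 2) := isBoundedInterval_Ioo (by norm_num)
    have h := isExtremal_phiZero
    exact ⟨h.memBMO, h.average_eq_zero, h.lpNormOn_pos hI hr0,
      le_antisymm (h.memBMO.lpNormOn_le hI h.average_eq_zero hp hr)
        ((mul_bmoSeminorm_rpow_le h.bmoSeminorm_le_one hexponent _).trans_eq
          (h.lpNormOn_eq_multConst_mul hp0 hr0).symm)⟩
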